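/- **Conventions.** All Hilbert spaces are complex, $\otimes$ is the completed tensor product, $\Sigma$ is the tensor flip, leg numbering notation is used, and $\mathfrak{Hilb}$ is the symmetric monoidal category of Hilbert spaces and bounded operators. **Braided multiplicative unitaries.** Let $\mathcal H\neq 0$ and $\mathcal L$ be Hilbert spaces and let $\mathbb W\in\mathcal U(\mathcal H\otimes\mathcal H)$ be a multiplicative unitary, that is, $\mathbb W_{23}\mathbb W_{12}=\mathbb W_{12}\mathbb W_{13}\mathbb W_{23}$. A right representation of $\mathbb W$ on $\mathcal K$ is $S\in\mathcal U(\mathcal K\otimes\mathcal H)$ with $\mathbb W_{23}S_{12}=S_{12}S_{13}\mathbb W_{23}$; a left representation of $\mathbb W$ on $\mathcal K$ is $V\in\mathcal U(\mathcal H\otimes\mathcal K)$ with $V_{23}\mathbb W_{12}=\mathbb W_{12}V_{13}V_{23}$. Given a left representation $V$ on $\mathcal L$ and a right representation $S$ on $\mathcal K$, the braiding operator $c_{\mathcal L,\mathcal K}\colon\mathcal L\otimes\mathcal K\to\mathcal K\otimes\mathcal L$ is $Z\Sigma$ for the unique $Z\in\mathcal U(\mathcal K\otimes\mathcal L)$ with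 $Z_{13}=V_{23}S_{12}^*V_{23}^*S_{12}$ in $\mathcal U(\mathcal K\otimes\mathcal H\otimes\mathcal L)$, provided that such a $Z$ exists (then it is unique). A braided multiplicative unitary over $\mathbb W$ consists of a right representation $U\in\mathcal U(\mathcal L\otimes\mathcal H)$ and a left representation $V\in\mathcal U(\mathcal H\otimes\mathcal L)$ of $\mathbb W$ on $\mathcal L$ and of $F\in\mathcal U(\mathcal L\otimes\mathcal L)$ such that $c_{\mathcal L,\mathcal L}$ (formed with $S=U$) exists and $$U_{23}\mathbb W_{13}V_{12}=V_{12}\mathbb W_{13}U_{23}\ \text{ on }\mathcal H\otimes\mathcal L\otimes\mathcal H,$$ $$U_{13}U_{23}F_{12}=F_{12}U_{13}U_{23}\ \text{ on }\mathcal L\otimes\mathcal L\otimes\mathcal H,\qquad V_{13}V_{12}F_{23}=F_{23}V_{13}V_{12}\ \text{ on }\mathcal H\otimes\mathcal L\otimes\mathcal L,$$ $$F_{23}F_{12}=F_{12}(c_{\mathcal L,\mathcal L})_{23}F_{12}(c_{\mathcal L,\mathcal L}^{-1})_{23}F_{23}\ \text{ on }\mathcal L\otimes\mathcal L\otimes\mathcal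 L.$$ **Representations.** A representation of $(\mathbb W,U,V,F)$ is a triple $(\mathcal K,S,T)$ where $S\in\mathcal U(\mathcal K\otimes\mathcal H)$ is a right representation of $\mathbb W$ for which the braiding operator $c_{\mathcal L,\mathcal K}$ exists, and $T\in\mathcal U(\mathcal K\otimes\mathcal L)$ satisfies $$S_{13}U_{23}T_{12}=T_{12}S_{13}U_{23}\ \text{ on }\mathcal K\otimes\mathcal L\otimes\mathcal H,\qquad F_{23}T_{12}=T_{12}(c_{\mathcal L,\mathcal L})_{23}T_{12}(c_{\mathcal L,\mathcal L}^{-1})_{23}F_{23}\ \text{ on }\mathcal K\otimes\mathcal L\otimes\mathcal L.$$ An arrow $(\mathcal K^1,S^1,T^1)\to(\mathcal K^2,S^2,T^2)$ is a bounded operator $a\colon\mathcal K^1\to\mathcal K^2$ with $a_1S^1=S^2a_1$ and $a_1T^1=T^2a_1$. Let $\mathfrak{For}(\mathcal K,S,T)=\mathcal K$ and $\tau(\mathcal K)=(\mathcal K,1,1)$, both acting identically on arrows, and let $$(\mathcal K^1,S^1,T^1)\otimes(\mathcal K^2,S^2,T^2)=\bigl(\mathcal K^1\otimes\mathcal K^2,\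 S^1_{13}S^2_{23},\ (c_{\mathcal L,\mathcal K^2})_{23}\,T^1_{12}\,(c_{\mathcal L,\mathcal K^2}^{-1})_{23}\,T^2_{23}\bigr).$$ **Statement.** With these definitions, the representations of $(\mathbb W,U,V,F)$ form a Hilbert space tensor category. That is: 1. The tensor product of two representations is again a representation, and $\otimes$ on objects extends to a monoidal category structure for which $\mathfrak{For}$ and $\tau$ are strict monoidal functors: they map tensor products of objects and arrows, the unit object, associators and unit transformations to the corresponding ones. In particular, $\tau(\mathbb C)$ is the tensor unit, the tensor product of arrows is the usual one, and $\otimes$ is associative through the usual associators of Hilbert spaces. 2. The functor $\mathfrak{For}$ is faithful, and it makes the category a $\mathrm W^*$-category: for all objects $x,y$ the arrows $x\to y$ form a linear subspace of $\mathbb B(\mathfrak{For}(x),\mathfrak{For}(y))$ that is closed in the weak operator topology, and adjoints of arrows are arrows. Moreover, $\mathfrak{For}\circ\tau=\mathrm{id}_{\mathfrak{Hilb}}$. 3. If $\mathfrak{For}(x)=\mathfrak{For}(x')$ and the identity operator on this Hilbert space is an arrow $x\to x'$, then $x=x'$. 4. If $a\colon\mathfrak{For}(x_1)\to\mathfrak{For}(x_2)$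 is a bounded operator and $y$ is an object with $\mathfrak{For}(y)\neq0$ such that $a\otimes\mathrm{id}$ is an arrow $x_1\otimes y\to x_2\otimes y$ or $\mathrm{id}\otimes a$ is an arrow $y\otimes x_1\to y\otimes x_2$, then $a$ is an arrow $x_1\to x_2$. -/

import Mathlib

open CategoryTheory MonoidalCategory UniformSpace
open scoped TensorProduct

universe u

/-- The category of complex Hilbert spaces. -/
structure Hilb : Type (u + 1) where
  carrier : Type u
  [normedAddCommGroup : NormedAddCommGroup carrier]
  [innerProductSpace : InnerProductSpace ℂ carrier]
  [completeSpace : CompleteSpace carrier]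

namespace Hilb

instance : CoeSort Hilb.{u} (Type u) := ⟨Hilb.carrier⟩

attribute [instance] normedAddCommGroup innerProductSpace completeSpace

/-- Morphisms of Hilbert spaces are the bounded linear operators. -/
@[ext]
structure Hom (A B : Hilb.{u}) where
  clm : A →L[ℂ] B

instance : Category Hilb.{u} where
  Hom A B := Hom A B
  id A := ⟨ContinuousLinearMap.id ℂ A⟩
  comp f g := ⟨g.clm.comp f.clm⟩

@[ext]
theorem hom_ext {A B : Hilb.{u}} {f g : A ⟶ B} (h : ∀ x, f.clm x = g.clm x) : f = g :=
  Hom.ext (ContinuousLinearMap.ext h)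

@[simp]
theorem id_clm (A : Hilb.{u}) : Hom.clm (𝟙 A) = ContinuousLinearMap.id ℂ A := rfl

@[simp]
theorem comp_clm {A B C : Hilb.{u}} (f : A ⟶ B) (g : B ⟶ C) :
    (f ≫ g).clm = g.clm.comp f.clm := rfl

/-- A surjective linear isometry as an isomorphism in the category of Hilbert spaces. -/
noncomputable def isoOfIsometry {A B : Hilb.{u}} (e : A ≃ₗᵢ[ℂ] B) : A ≅ B where
  hom := ⟨e.toContinuousLinearEquiv.toContinuousLinearMap⟩
  inv := ⟨e.symm.toContinuousLinearEquiv.toContinuousLinearMap⟩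
  hom_inv_id := by ext x; exact e.symm_apply_apply x
  inv_hom_id := by ext x; exact e.apply_symm_apply x

/-- The adjoint operator. -/
noncomputable def dag {A B : Hilb.{u}} (f : A ⟶ B) : B ⟶ A :=
  ⟨ContinuousLinearMap.adjoint f.clm⟩

/-- Unitary operators between Hilbert spaces. -/
structure IsUnitary {A B : Hilb.{u}} (f : A ⟶ B) : Prop where
  comp_dag : f ≫ dag f = 𝟙 A
  dag_comp : dag f ≫ f = 𝟙 B

section Unbundled

variable {E F E' F' : Type*} [NormedAddCommGroup E] [InnerProductSpace ℂ E]
  [NormedAddCommGroup F] [InnerProductSpace ℂ F]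
  [NormedAddCommGroup E'] [InnerProductSpace ℂ E'] [NormedAddCommGroup F'] [InnerProductSpace ℂ F']

theorem denseRange_mapIsometry (f : E →ₗᵢ[ℂ] E') (g : F →ₗᵢ[ℂ] F') (hf : DenseRange f)
    (hg : DenseRange g) : DenseRange (TensorProduct.mapIsometry f g) := by
  have key : (LinearMap.range (TensorProduct.mapIsometry f g).toLinearMap).topologicalClosure
      = ⊤ := by
    rw [eq_top_iff, ← TensorProduct.span_tmul_eq_top, Submodule.span_le]
    rintro _ ⟨x, y, rfl⟩
    have h1 : (x, y) ∈ closure (Set.range (Prod.map f g)) := (hf.prodMap hg) (x, y)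
    have h2 := map_mem_closure (TensorProduct.continuous_tmul (𝕜 := ℂ) (E := E') (F := F')) h1
      (t := (LinearMap.range (TensorProduct.mapIsometry f g).toLinearMap : Set (E' ⊗[ℂ] F'))) (by
        rintro _ ⟨⟨a, b⟩, rfl⟩
        exact ⟨a ⊗ₜ b, rfl⟩)
    exact h2
  intro x
  have : x ∈ (LinearMap.range (TensorProduct.mapIsometry f g).toLinearMap).topologicalClosure := by
    rw [key]; trivial
  exact this

end Unbundled

/-- The Hilbert space tensor product: the completion of the algebraic tensor product. -/
noncomputable def tensor (A B : Hilb.{u}) : Hilb.{u} := ⟨Completion (A ⊗[ℂ] B)⟩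

/-- The dense inclusion of the algebraic tensor product. -/
noncomputable def incl (A B : Hilb.{u}) : A ⊗[ℂ] B →ₗᵢ[ℂ] tensor A B :=
  Completion.toComplₗᵢ

theorem denseRange_incl (A B : Hilb.{u}) : DenseRange (incl A B) :=
  Completion.denseRange_coe

/-- The dense inclusion of the algebraic triple tensor product, bracketed to the left. -/
noncomputable def inclL (A B C : Hilb.{u}) : (A ⊗[ℂ] B) ⊗[ℂ] C →ₗᵢ[ℂ] tensor (tensor A B) C :=
  (incl (tensor A B) C).comp
    (TensorProduct.mapIsometry (incl A B) (LinearIsometry.id (R := ℂ) (E := C)))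

/-- The dense inclusion of the algebraic triple tensor product, bracketed to the right. -/
noncomputable def inclR (A B C : Hilb.{u}) : A ⊗[ℂ] (B ⊗[ℂ] C) →ₗᵢ[ℂ] tensor A (tensor B C) :=
  (incl A (tensor B C)).comp
    (TensorProduct.mapIsometry (LinearIsometry.id (R := ℂ) (E := A)) (incl B C))

theorem denseRange_inclL (A B C : Hilb.{u}) : DenseRange (inclL A B C) :=
  (denseRange_incl (tensor A B) C).comp (denseRange_mapIsometry (incl A B)
    (LinearIsometry.id (R := ℂ) (E := C)) (denseRange_incl A B)
    Function.surjective_id.denseRange) (incl (tensor A B) C).continuous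

theorem denseRange_inclR (A B C : Hilb.{u}) : DenseRange (inclR A B C) :=
  (denseRange_incl A (tensor B C)).comp (denseRange_mapIsometry
    (LinearIsometry.id (R := ℂ) (E := A)) (incl B C) Function.surjective_id.denseRange
    (denseRange_incl B C)) (incl A (tensor B C)).continuous

theorem norm_inclR_assoc (A B C : Hilb.{u}) (x : (A ⊗[ℂ] B) ⊗[ℂ] C) :
    ‖(inclR A B C).toLinearMap (TensorProduct.assoc ℂ A B C x)‖ =
      ‖(inclL A B C).toLinearMap x‖ :=
  ((inclR A B C).norm_map _).trans
    ((TensorProduct.norm_assoc x).trans ((inclL A B C).norm_map x).symm)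

/-- The associator, which extends `(a ⊗ b) ⊗ c ↦ a ⊗ (b ⊗ c)`. -/
noncomputable def assoc (A B C : Hilb.{u}) : tensor (tensor A B) C ≅ tensor A (tensor B C) :=
  isoOfIsometry ((TensorProduct.assoc ℂ A B C).extendOfIsometry (inclL A B C).toLinearMap
    (inclR A B C).toLinearMap (denseRange_inclL A B C) (denseRange_inclR A B C)
    (norm_inclR_assoc A B C))

theorem norm_incl_comm (A B : Hilb.{u}) (x : A ⊗[ℂ] B) :
    ‖(incl B A).toLinearMap (TensorProduct.comm ℂ A B x)‖ = ‖(incl A B).toLinearMap x‖ :=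
  ((incl B A).norm_map _).trans ((TensorProduct.norm_comm x).trans ((incl A B).norm_map x).symm)

/-- The flip `Σ`, which extends `a ⊗ b ↦ b ⊗ a`. -/
noncomputable def flip (A B : Hilb.{u}) : tensor A B ≅ tensor B A :=
  isoOfIsometry ((TensorProduct.comm ℂ A B).extendOfIsometry (incl A B).toLinearMap
    (incl B A).toLinearMap (denseRange_incl A B) (denseRange_incl B A) (norm_incl_comm A B))

/-- Elementary tensors. -/
noncomputable def tmul {A B : Hilb.{u}} (a : A) (b : B) : tensor A B :=
  incl A B (a ⊗ₜ b)

/-- Elementary tensors as a continuous bilinear map. -/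
noncomputable def tmulL (A B : Hilb.{u}) : A →L[ℂ] B →L[ℂ] tensor A B :=
  (ContinuousLinearMap.compL ℂ B (A ⊗[ℂ] B) (tensor A B) (incl A B).toContinuousLinearMap).comp
    (TensorProduct.mkL ℂ A B)

theorem tmulL_apply {A B : Hilb.{u}} (a : A) (b : B) : tmulL A B a b = tmul a b := rfl

theorem clm_ext {A B : Hilb.{u}} {X : Type*} [NormedAddCommGroup X] [NormedSpace ℂ X]
    {f g : tensor A B →L[ℂ] X} (h : ∀ a b, f (tmul a b) = g (tmul a b)) : f = g := by
  have h1 : f.comp (Completion.toComplL (𝕜 := ℂ) (E := A ⊗[ℂ] B)) =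
      g.comp (Completion.toComplL (𝕜 := ℂ) (E := A ⊗[ℂ] B)) := by
    apply ContinuousLinearMap.coe_injective
    apply TensorProduct.ext'
    exact h
  ext x
  refine Completion.induction_on (p := fun x => f x = g x) x
    (isClosed_eq f.continuous g.continuous) (fun a => ?_)
  exact DFunLike.congr_fun h1 a

theorem tensor_ext {A B X : Hilb.{u}} {f g : tensor A B ⟶ X}
    (h : ∀ a b, f.clm (tmul a b) = g.clm (tmul a b)) : f = g :=
  Hom.ext (clm_ext h)

theorem tensor_ext_left {A B C X : Hilb.{u}} {f g : tensor (tensor A B) C ⟶ X}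
    (h : ∀ a b c, f.clm (tmul (tmul a b) c) = g.clm (tmul (tmul a b) c)) : f = g := by
  refine tensor_ext fun x c => ?_
  exact DFunLike.congr_fun (clm_ext (f := f.clm.comp ((tmulL (tensor A B) C).flip c))
    (g := g.clm.comp ((tmulL (tensor A B) C).flip c)) (fun a b => h a b c)) x

theorem tensor_ext_right {A B C X : Hilb.{u}} {f g : tensor A (tensor B C) ⟶ X}
    (h : ∀ a b c, f.clm (tmul a (tmul b c)) = g.clm (tmul a (tmul b c))) : f = g := by
  refine tensor_ext fun a x => ?_
  exact DFunLike.congr_fun (clm_ext (f := f.clm.comp (tmulL A (tensor B C) a))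
    (g := g.clm.comp (tmulL A (tensor B C) a)) (fun b c => h a b c)) x

theorem tensor_ext_four {A B C D X : Hilb.{u}} {f g : tensor (tensor (tensor A B) C) D ⟶ X}
    (h : ∀ a b c d, f.clm (tmul (tmul (tmul a b) c) d) = g.clm (tmul (tmul (tmul a b) c) d)) :
    f = g := by
  refine tensor_ext fun x d => ?_
  have := tensor_ext_left (f := ⟨f.clm.comp ((tmulL (tensor (tensor A B) C) D).flip d)⟩)
    (g := ⟨g.clm.comp ((tmulL (tensor (tensor A B) C) D).flip d)⟩) (fun a b c => h a b c d)
  exact congrArg (fun k : tensor (tensor A B) C ⟶ X => k.clm x) this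

/-- The tensor product of bounded operators. -/
noncomputable def map {A B C D : Hilb.{u}} (f : A ⟶ B) (g : C ⟶ D) : tensor A C ⟶ tensor B D :=
  ⟨(TensorProduct.mapL f.clm g.clm).completion⟩

@[simp]
theorem map_tmul {A B C D : Hilb.{u}} (f : A ⟶ B) (g : C ⟶ D) (a : A) (c : C) :
    (map f g).clm (tmul a c) = tmul (f.clm a) (g.clm c) :=
  ContinuousLinearMap.completion_apply_coe _ _

@[simp]
theorem assoc_hom_tmul {A B C : Hilb.{u}} (a : A) (b : B) (c : C) :
    (assoc A B C).hom.clm (tmul (tmul a b) c) = tmul a (tmul b c) :=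
  LinearEquiv.extendOfIsometry_eq (TensorProduct.assoc ℂ A B C) (inclL A B C).toLinearMap
    (inclR A B C).toLinearMap (denseRange_inclL A B C) (denseRange_inclR A B C)
    (norm_inclR_assoc A B C) ((a ⊗ₜ b) ⊗ₜ c)

@[simp]
theorem assoc_inv_tmul {A B C : Hilb.{u}} (a : A) (b : B) (c : C) :
    (assoc A B C).inv.clm (tmul a (tmul b c)) = tmul (tmul a b) c :=
  LinearEquiv.extendOfIsometry_symm_eq (TensorProduct.assoc ℂ A B C) (inclL A B C).toLinearMap
    (inclR A B C).toLinearMap (denseRange_inclL A B C) (denseRange_inclR A B C)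
    (norm_inclR_assoc A B C) (a ⊗ₜ (b ⊗ₜ c))

@[simp]
theorem flip_hom_tmul {A B : Hilb.{u}} (a : A) (b : B) :
    (flip A B).hom.clm (tmul a b) = tmul b a :=
  LinearEquiv.extendOfIsometry_eq (TensorProduct.comm ℂ A B) (incl A B).toLinearMap
    (incl B A).toLinearMap (denseRange_incl A B) (denseRange_incl B A) (norm_incl_comm A B)
    (a ⊗ₜ b)

noncomputable instance : InnerProductSpace ℂ (ULift.{u} ℂ) where
  inner x y := inner ℂ x.down y.down
  norm_sq_eq_re_inner x := norm_sq_eq_re_inner (𝕜 := ℂ) x.down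
  conj_inner_symm x y := inner_conj_symm x.down y.down
  add_left x y z := inner_add_left x.down y.down z.down
  smul_left x y c := inner_smul_left x.down y.down c

/-- The tensor unit `ℂ`. -/
noncomputable def unit : Hilb.{u} := ⟨ULift.{u} ℂ⟩

/-- The canonical isometry `ℂ ⊗ A ≅ A` on the algebraic tensor product. -/
noncomputable def lunitAlg (A : Hilb.{u}) : ULift.{u} ℂ ⊗[ℂ] A ≃ₗᵢ[ℂ] A :=
  (TensorProduct.congrIsometry (LinearIsometryEquiv.ulift ℂ ℂ)
    (LinearIsometryEquiv.refl ℂ A)).trans (TensorProduct.lidIsometry ℂ A)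

theorem norm_lunitAlg (A : Hilb.{u}) (x : ULift.{u} ℂ ⊗[ℂ] A) :
    ‖(LinearMap.id : A →ₗ[ℂ] A) ((lunitAlg A).toLinearEquiv x)‖ =
      ‖(Completion.toComplₗᵢ (𝕜 := ℂ) (E := ULift.{u} ℂ ⊗[ℂ] A)).toLinearMap x‖ :=
  ((lunitAlg A).norm_map x).trans (Completion.norm_coe x).symm

/-- The left unit transformation. -/
noncomputable def lunit (A : Hilb.{u}) : tensor unit A ≅ A :=
  isoOfIsometry (A := tensor unit A) (LinearEquiv.extendOfIsometry (lunitAlg A).toLinearEquiv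
    (Completion.toComplₗᵢ (𝕜 := ℂ) (E := ULift.{u} ℂ ⊗[ℂ] A)).toLinearMap LinearMap.id
    Completion.denseRange_coe Function.surjective_id.denseRange (norm_lunitAlg A))

@[simp]
theorem lunit_hom_tmul {A : Hilb.{u}} (c : unit.{u}) (a : A) :
    (lunit A).hom.clm (tmul c a) = (ULift.down c : ℂ) • a :=
  LinearEquiv.extendOfIsometry_eq (lunitAlg A).toLinearEquiv
    (Completion.toComplₗᵢ (𝕜 := ℂ) (E := ULift.{u} ℂ ⊗[ℂ] A)).toLinearMap LinearMap.id
    Completion.denseRange_coe Function.surjective_id.denseRange (norm_lunitAlg A) (c ⊗ₜ a)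

/-- The right unit transformation. -/
noncomputable def runit (A : Hilb.{u}) : tensor A unit ≅ A :=
  flip A unit ≪≫ lunit A

@[simp]
theorem runit_hom_tmul {A : Hilb.{u}} (c : unit.{u}) (a : A) :
    (runit A).hom.clm (tmul a c) = (ULift.down c : ℂ) • a := by
  simp [runit]

noncomputable instance : MonoidalCategoryStruct Hilb.{u} where
  tensorObj := tensor
  whiskerLeft A _ _ f := map (𝟙 A) f
  whiskerRight f B := map f (𝟙 B)
  tensorHom f g := map f g
  tensorUnit := unit
  associator := assoc
  leftUnitor := lunit
  rightUnitor := runit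

theorem smul_tmul {A B : Hilb.{u}} (c : ℂ) (a : A) (b : B) :
    tmul (c • a) b = tmul a (c • b) :=
  congrArg (fun t : A ⊗[ℂ] B => (t : Completion (A ⊗[ℂ] B))) (TensorProduct.smul_tmul c a b)

noncomputable instance : MonoidalCategory Hilb.{u} :=
  MonoidalCategory.ofTensorHom
    (id_tensorHom_id := fun A B => tensor_ext fun a b => map_tmul (𝟙 A) (𝟙 B) a b)
    (id_tensorHom := fun _ _ _ _ => rfl)
    (tensorHom_id := fun _ _ => rfl)
    (tensorHom_comp_tensorHom := fun f₁ f₂ g₁ g₂ => tensor_ext fun a b => by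
      change (map g₁ g₂).clm ((map f₁ f₂).clm (tmul a b)) = (map (f₁ ≫ g₁) (f₂ ≫ g₂)).clm (tmul a b)
      simp)
    (associator_naturality := fun {X₁ X₂ X₃ Y₁ Y₂ Y₃} f₁ f₂ f₃ => tensor_ext_left fun a b c => by
      change (assoc Y₁ Y₂ Y₃).hom.clm ((map (map f₁ f₂) f₃).clm (tmul (tmul a b) c)) =
        (map f₁ (map f₂ f₃)).clm ((assoc X₁ X₂ X₃).hom.clm (tmul (tmul a b) c))
      simp)
    (leftUnitor_naturality := fun {X Y} f => tensor_ext fun c a => by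
      change (lunit Y).hom.clm ((map (𝟙 unit) f).clm (tmul c a)) =
        f.clm ((lunit X).hom.clm (tmul c a))
      simp)
    (rightUnitor_naturality := fun {X Y} f => tensor_ext fun a c => by
      change (runit Y).hom.clm ((map f (𝟙 unit)).clm (tmul a c)) =
        f.clm ((runit X).hom.clm (tmul a c))
      simp)
    (pentagon := fun W X Y Z => tensor_ext_four fun a b c d => by
      change (map (𝟙 W) (assoc X Y Z).hom).clm ((assoc W (tensor X Y) Z).hom.clm
        ((map (assoc W X Y).hom (𝟙 Z)).clm (tmul (tmul (tmul a b) c) d))) =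
        (assoc W X (tensor Y Z)).hom.clm ((assoc (tensor W X) Y Z).hom.clm
          (tmul (tmul (tmul a b) c) d))
      simp)
    (triangle := fun X Y => tensor_ext_left fun a c b => by
      change (map (𝟙 X) (lunit Y).hom).clm ((assoc X unit Y).hom.clm (tmul (tmul a c) b)) =
        (map (runit X).hom (𝟙 Y)).clm (tmul (tmul a c) b)
      simp [smul_tmul])

noncomputable instance : SymmetricCategory Hilb.{u} where
  braiding := flip
  braiding_naturality_right X {Y Z} f := tensor_ext fun a b => by
    change (flip X Z).hom.clm ((map (𝟙 X) f).clm (tmul a b)) =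
      (map f (𝟙 X)).clm ((flip X Y).hom.clm (tmul a b))
    simp
  braiding_naturality_left {X Y} f Z := tensor_ext fun a b => by
    change (flip Y Z).hom.clm ((map f (𝟙 Z)).clm (tmul a b)) =
      (map (𝟙 Z) f).clm ((flip X Z).hom.clm (tmul a b))
    simp
  hexagon_forward X Y Z := tensor_ext_left fun a b c => by
    change (assoc Y Z X).hom.clm ((flip X (tensor Y Z)).hom.clm
        ((assoc X Y Z).hom.clm (tmul (tmul a b) c))) =
      (map (𝟙 Y) (flip X Z).hom).clm ((assoc Y X Z).hom.clm
        ((map (flip X Y).hom (𝟙 Z)).clm (tmul (tmul a b) c)))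
    simp
  hexagon_reverse X Y Z := tensor_ext_right fun a b c => by
    change (assoc Z X Y).inv.clm ((flip (tensor X Y) Z).hom.clm
        ((assoc X Y Z).inv.clm (tmul a (tmul b c)))) =
      (map (flip X Z).hom (𝟙 Y)).clm ((assoc X Z Y).inv.clm
        ((map (𝟙 X) (flip Y Z).hom).clm (tmul a (tmul b c))))
    simp
  symmetry X Y := tensor_ext fun a b => by
    change (flip Y X).hom.clm ((flip X Y).hom.clm (tmul a b)) = tmul a b
    simp

end Hilb

/-- Composition in operator order: `g ∘ₒ f` is `f` followed by `g`. -/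
notation:80 g:81 " ∘ₒ " f:80 => CategoryStruct.comp f g

namespace Hilb

section Legs

variable {A B C A' B' C' : Hilb.{u}}

/-- Leg numbering: `f₁₂ = f ⊗ 1`. -/
noncomputable def leg12 (C : Hilb.{u}) (f : A ⊗ B ⟶ A' ⊗ B') :
    (A ⊗ B) ⊗ C ⟶ (A' ⊗ B') ⊗ C :=
  f ▷ C

/-- Leg numbering: `f₂₃ = 1 ⊗ f`. -/
noncomputable def leg23 (A : Hilb.{u}) (f : B ⊗ C ⟶ B' ⊗ C') :
    (A ⊗ B) ⊗ C ⟶ (A ⊗ B') ⊗ C' :=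
  (α_ A B' C').inv ∘ₒ (A ◁ f) ∘ₒ (α_ A B C).hom

/-- Leg numbering: `f₁₃ = Σ₂₃ f₁₂ Σ₂₃`, acting trivially on the second leg `B`. -/
noncomputable def leg13 (B : Hilb.{u}) (f : A ⊗ C ⟶ A' ⊗ C') :
    (A ⊗ B) ⊗ C ⟶ (A' ⊗ B) ⊗ C' :=
  leg23 A' (β_ C' B).hom ∘ₒ leg12 B f ∘ₒ leg23 A (β_ B C).hom

end Legs

variable {H L K : Hilb.{u}}

/-- Multiplicative unitaries: unitaries that satisfy the pentagon equation
`W₂₃ W₁₂ = W₁₂ W₁₃ W₂₃`. -/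
structure IsMultiplicative (W : H ⊗ H ⟶ H ⊗ H) : Prop where
  unitary : IsUnitary W
  pentagon : leg23 H W ∘ₒ leg12 H W = leg12 H W ∘ₒ leg13 H W ∘ₒ leg23 H W

/-- Right representations of `W` on `K`: unitaries `S` on `K ⊗ H` with
`W₂₃ S₁₂ = S₁₂ S₁₃ W₂₃` on `K ⊗ H ⊗ H`. -/
structure IsRightRep (W : H ⊗ H ⟶ H ⊗ H) (S : K ⊗ H ⟶ K ⊗ H) : Prop where
  unitary : IsUnitary S
  rep : leg23 K W ∘ₒ leg12 H S = leg12 H S ∘ₒ leg13 H S ∘ₒ leg23 K W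

/-- Left representations of `W` on `K`: unitaries `V` on `H ⊗ K` with
`V₂₃ W₁₂ = W₁₂ V₁₃ V₂₃` on `H ⊗ H ⊗ K`. -/
structure IsLeftRep (W : H ⊗ H ⟶ H ⊗ H) (V : H ⊗ K ⟶ H ⊗ K) : Prop where
  unitary : IsUnitary V
  rep : leg23 H V ∘ₒ leg12 K W = leg12 K W ∘ₒ leg13 H V ∘ₒ leg23 H V

/-- `Z` is the unitary on `K ⊗ L` with `Z₁₃ = V₂₃ S₁₂* V₂₃* S₁₂` on `K ⊗ H ⊗ L`. -/
structure IsBraidingUnitary (V : H ⊗ L ⟶ H ⊗ L) (S : K ⊗ H ⟶ K ⊗ H) (Z : K ⊗ L ⟶ K ⊗ L) :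
    Prop where
  unitary : IsUnitary Z
  eq : leg13 H Z = leg23 K V ∘ₒ leg12 L (dag S) ∘ₒ leg23 K (dag V) ∘ₒ leg12 L S

/-- The unitary `Z` that defines the braiding exists. -/
def HasBraiding (V : H ⊗ L ⟶ H ⊗ L) (S : K ⊗ H ⟶ K ⊗ H) : Prop :=
  ∃ Z : K ⊗ L ⟶ K ⊗ L, IsBraidingUnitary V S Z

open Classical in
/-- The unitary `Z` that defines the braiding; it is unique if `H ≠ 0`. It is only used where it
exists; the default value is the identity. -/
noncomputable def braidZ (V : H ⊗ L ⟶ H ⊗ L) (S : K ⊗ H ⟶ K ⊗ H) : K ⊗ L ⟶ K ⊗ L :=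
  if h : HasBraiding V S then h.choose else 𝟙 (K ⊗ L)

/-- The braiding operator `L ⊗ K ⟶ K ⊗ L`, that is, `Z Σ`. -/
noncomputable def braid (V : H ⊗ L ⟶ H ⊗ L) (S : K ⊗ H ⟶ K ⊗ H) : L ⊗ K ⟶ K ⊗ L :=
  braidZ V S ∘ₒ (β_ L K).hom

/-- The dual braiding operator `K ⊗ L ⟶ L ⊗ K`, the inverse of the unitary `braid V S`. -/
noncomputable def dualBraid (V : H ⊗ L ⟶ H ⊗ L) (S : K ⊗ H ⟶ K ⊗ H) : K ⊗ L ⟶ L ⊗ K :=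
  dag (braid V S)

/-- The tensor product `S¹₁₃ S²₂₃` of right representations. -/
noncomputable def tensorS {K₁ K₂ : Hilb.{u}} (S₁ : K₁ ⊗ H ⟶ K₁ ⊗ H) (S₂ : K₂ ⊗ H ⟶ K₂ ⊗ H) :
    (K₁ ⊗ K₂) ⊗ H ⟶ (K₁ ⊗ K₂) ⊗ H :=
  leg13 K₂ S₁ ∘ₒ leg23 K₁ S₂

/-- The braided tensor product of `T₁` and `T₂`; the braiding is that of `L` with `(K₂, S₂)`. -/
noncomputable def tensorT {K₁ K₂ : Hilb.{u}} (V : H ⊗ L ⟶ H ⊗ L) (T₁ : K₁ ⊗ L ⟶ K₁ ⊗ L)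
    (S₂ : K₂ ⊗ H ⟶ K₂ ⊗ H) (T₂ : K₂ ⊗ L ⟶ K₂ ⊗ L) :
    (K₁ ⊗ K₂) ⊗ L ⟶ (K₁ ⊗ K₂) ⊗ L :=
  leg23 K₁ (braid V S₂) ∘ₒ leg12 K₂ T₁ ∘ₒ leg23 K₁ (dualBraid V S₂) ∘ₒ leg23 K₁ T₂

end Hilb

open Hilb

/-- Braided multiplicative unitaries `(W, U, V, F)` on the Hilbert spaces `H` and `L`. -/
structure BraidedMultUnitary (H L : Hilb.{u}) where
  W : H ⊗ H ⟶ H ⊗ H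
  U : L ⊗ H ⟶ L ⊗ H
  V : H ⊗ L ⟶ H ⊗ L
  F : L ⊗ L ⟶ L ⊗ L
  W_mult : IsMultiplicative W
  U_rep : IsRightRep W U
  V_rep : IsLeftRep W V
  /-- `U` and `V` are Drinfeld compatible: `U₂₃ W₁₃ V₁₂ = V₁₂ W₁₃ U₂₃` on `H ⊗ L ⊗ H`. -/
  drinfeld : leg23 H U ∘ₒ leg13 L W ∘ₒ leg12 H V = leg12 H V ∘ₒ leg13 L W ∘ₒ leg23 H U
  F_unitary : IsUnitary F
  /-- `F` is equivariant for `U`: `U₁₃ U₂₃ F₁₂ = F₁₂ U₁₃ U₂₃` on `L ⊗ L ⊗ H`. -/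
  F_U : leg13 L U ∘ₒ leg23 L U ∘ₒ leg12 H F = leg12 H F ∘ₒ leg13 L U ∘ₒ leg23 L U
  /-- `F` is equivariant for `V`: `V₁₃ V₁₂ F₂₃ = F₂₃ V₁₃ V₁₂` on `H ⊗ L ⊗ L`. -/
  F_V : leg13 L V ∘ₒ leg12 L V ∘ₒ leg23 H F = leg23 H F ∘ₒ leg13 L V ∘ₒ leg12 L V
  /-- The braiding operator on `L ⊗ L` exists. -/
  U_braid : HasBraiding V U
  /-- The top-braided pentagon equation on `L ⊗ L ⊗ L`. -/
  pentagon : leg23 L F ∘ₒ leg12 L F =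
    leg12 L F ∘ₒ leg23 L (braid V U) ∘ₒ leg12 L F ∘ₒ leg23 L (dualBraid V U) ∘ₒ leg23 L F

namespace BraidedMultUnitary

variable {H L : Hilb.{u}} (B : BraidedMultUnitary H L)

/-- Right representations `(K, S, T)` of a braided multiplicative unitary. That the braiding
operator of `L` with `(K, S)` exists is part of the definition. -/
structure IsRep {K : Hilb.{u}} (S : K ⊗ H ⟶ K ⊗ H) (T : K ⊗ L ⟶ K ⊗ L) : Prop where
  S_rep : IsRightRep B.W S
  S_braid : HasBraiding B.V S
  T_unitary : IsUnitary T
  /-- `S₁₃ U₂₃ T₁₂ = T₁₂ S₁₃ U₂₃` on `K ⊗ L ⊗ H`. -/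
  T_equivariant : leg13 L S ∘ₒ leg23 K B.U ∘ₒ leg12 H T = leg12 H T ∘ₒ leg13 L S ∘ₒ leg23 K B.U
  /-- The top-braided representation condition on `K ⊗ L ⊗ L`. -/
  T_rep : leg23 K B.F ∘ₒ leg12 L T = leg12 L T ∘ₒ leg23 K (braid B.V B.U) ∘ₒ leg12 L T ∘ₒ
    leg23 K (dualBraid B.V B.U) ∘ₒ leg23 K B.F

/-- The objects of the category of right representations. -/
structure Rep : Type (u + 1) where
  K : Hilb.{u}
  S : K ⊗ H ⟶ K ⊗ H
  T : K ⊗ L ⟶ K ⊗ L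
  isRep : B.IsRep S T

variable {B}

/-- The arrows are the bounded operators that intertwine both representations. -/
@[ext]
structure Rep.Hom (x y : B.Rep) where
  map : x.K ⟶ y.K
  S_comm : (map ▷ H) ∘ₒ x.S = y.S ∘ₒ (map ▷ H)
  T_comm : (map ▷ L) ∘ₒ x.T = y.T ∘ₒ (map ▷ L)

instance : Category B.Rep where
  Hom x y := Rep.Hom x y
  id x := ⟨𝟙 x.K, by simp, by simp⟩
  comp f g := ⟨f.map ≫ g.map,
    by rw [comp_whiskerRight, ← Category.assoc, f.S_comm, Category.assoc, g.S_comm,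
      Category.assoc],
    by rw [comp_whiskerRight, ← Category.assoc, f.T_comm, Category.assoc, g.T_comm,
      Category.assoc]⟩

variable (B)

/-- The forgetful functor to Hilbert spaces. -/
def forget : B.Rep ⥤ Hilb.{u} where
  obj x := x.K
  map f := f.map

end BraidedMultUnitary

namespace Hilb

theorem dag_id (A : Hilb.{u}) : dag (𝟙 A) = 𝟙 A :=
  Hom.ext ContinuousLinearMap.adjoint_id

theorem dag_comp {A B C : Hilb.{u}} (f : A ⟶ B) (g : B ⟶ C) : dag (f ≫ g) = dag g ≫ dag f :=
  Hom.ext (ContinuousLinearMap.adjoint_comp g.clm f.clm)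

theorem isUnitary_id (A : Hilb.{u}) : IsUnitary (𝟙 A) := by
  constructor <;> simp [dag_id]

theorem IsUnitary.comp {A B C : Hilb.{u}} {f : A ⟶ B} {g : B ⟶ C} (hf : IsUnitary f)
    (hg : IsUnitary g) : IsUnitary (f ≫ g) where
  comp_dag := by
    rw [Hilb.dag_comp, Category.assoc, ← Category.assoc g, hg.comp_dag, Category.id_comp, hf.comp_dag]
  dag_comp := by
    rw [Hilb.dag_comp, Category.assoc, ← Category.assoc _ f, hf.dag_comp, Category.id_comp,
      hg.dag_comp]

theorem isUnitary_isoOfIsometry {A B : Hilb.{u}} (e : A ≃ₗᵢ[ℂ] B) :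
    IsUnitary (isoOfIsometry e).hom := by
  have h : dag (isoOfIsometry e).hom = (isoOfIsometry e).inv :=
    Hom.ext (LinearIsometryEquiv.adjoint_eq_symm e)
  constructor <;> simp [h]

theorem isUnitary_braiding (A B : Hilb.{u}) : IsUnitary (β_ A B).hom :=
  isUnitary_isoOfIsometry _

variable {A B C H K L : Hilb.{u}}

theorem leg12_id : leg12 C (𝟙 (A ⊗ B)) = 𝟙 ((A ⊗ B) ⊗ C) := by simp [leg12]

theorem leg23_id : leg23 A (𝟙 (B ⊗ C)) = 𝟙 ((A ⊗ B) ⊗ C) := by simp [leg23]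

theorem leg23_comp {B' C' B'' C'' : Hilb.{u}} (f : B ⊗ C ⟶ B' ⊗ C') (g : B' ⊗ C' ⟶ B'' ⊗ C'') :
    leg23 A f ≫ leg23 A g = leg23 A (f ≫ g) := by simp [leg23]

theorem leg13_id : leg13 B (𝟙 (A ⊗ C)) = 𝟙 ((A ⊗ B) ⊗ C) := by
  rw [leg13, leg12_id, Category.comp_id, leg23_comp, SymmetricCategory.symmetry, leg23_id]

theorem braidZ_spec {V : H ⊗ L ⟶ H ⊗ L} {S : K ⊗ H ⟶ K ⊗ H} (h : HasBraiding V S) :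
    IsBraidingUnitary V S (braidZ V S) := by
  rw [braidZ, dif_pos h]
  exact h.choose_spec

theorem isUnitary_braid {V : H ⊗ L ⟶ H ⊗ L} {S : K ⊗ H ⟶ K ⊗ H} (h : HasBraiding V S) :
    IsUnitary (braid V S) :=
  (isUnitary_braiding L K).comp (braidZ_spec h).unitary

end Hilb

namespace BraidedMultUnitary

variable {H L : Hilb.{u}} (B : BraidedMultUnitary H L)

theorem isRep_trivial (K : Hilb.{u}) : B.IsRep (𝟙 (K ⊗ H)) (𝟙 (K ⊗ L)) where
  S_rep := ⟨isUnitary_id _, by simp [leg12_id, leg13_id]⟩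
  S_braid := ⟨𝟙 _, isUnitary_id _, by
    simp [leg12_id, leg13_id, dag_id, leg23_comp, B.V_rep.unitary.dag_comp, leg23_id]⟩
  T_unitary := isUnitary_id _
  T_equivariant := by simp [leg12_id, leg13_id]
  T_rep := by
    simp [leg12_id, leg23_comp, dualBraid, (isUnitary_braid B.U_braid).dag_comp]

/-- The functor `τ`, which equips a Hilbert space `K` with the trivial representation
`(K, 1, 1)`. -/
noncomputable def trivial : Hilb.{u} ⥤ B.Rep where
  obj K := ⟨K, 𝟙 _, 𝟙 _, B.isRep_trivial K⟩
  map f := ⟨f, by simp, by simp⟩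

end BraidedMultUnitary

/-- Strict monoidal functors. Heterogeneous equality identifies arrows along the equalities of
objects `F (x ⊗ y) = F x ⊗ F y` and `F 1 = 1`. -/
structure IsStrictMonoidal {C D : Type*} [Category C] [MonoidalCategory C] [Category D]
    [MonoidalCategory D] (F : C ⥤ D) : Prop where
  obj_tensor : ∀ x y : C, F.obj (x ⊗ y) = F.obj x ⊗ F.obj y
  obj_unit : F.obj (𝟙_ C) = 𝟙_ D
  map_tensor : ∀ {x x' y y' : C} (f : x ⟶ x') (g : y ⟶ y'),
    HEq (F.map (f ⊗ₘ g)) (F.map f ⊗ₘ F.map g)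
  map_associator : ∀ x y z : C,
    HEq (F.map (α_ x y z).hom) (α_ (F.obj x) (F.obj y) (F.obj z)).hom
  map_leftUnitor : ∀ x : C, HEq (F.map (λ_ x).hom) (λ_ (F.obj x)).hom
  map_rightUnitor : ∀ x : C, HEq (F.map (ρ_ x).hom) (ρ_ (F.obj x)).hom

/-- A faithful functor to Hilbert spaces makes its domain a (concrete) W*-category: its arrow
spaces are identified with weakly closed linear subspaces of the spaces of bounded operators, and
adjoints of arrows are arrows. -/
structure IsConcreteWStar {C : Type*} [Category C] (For : C ⥤ Hilb.{u}) : Prop where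
  faithful : For.Faithful
  linear : ∀ x y : C, ∃ M : Submodule ℂ (For.obj x →L[ℂ] For.obj y),
    (M : Set (For.obj x →L[ℂ] For.obj y)) = Set.range fun f : x ⟶ y => (For.map f).clm
  adjoint : ∀ {x y : C} (f : x ⟶ y), ∃ g : y ⟶ x, For.map g = dag (For.map f)
  weakly_closed : ∀ x y : C,
    IsClosed {a : For.obj x →WOT[ℂ] For.obj y | ∃ f : x ⟶ y, (For.map f).clm = a.toCLM}

/-- Hilbert space tensor categories: monoidal W*-categories `C` with a faithful strict monoidal
functor `For` to Hilbert spaces and a strict monoidal functor `τ` from Hilbert spaces with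
`For ∘ τ = id`, such that (1) objects with the same underlying Hilbert space are equal once the
identity operator is an arrow between them, and (2) an operator `a` comes from an arrow once
`a ⊗ 1` or `1 ⊗ a` does so, where the other factor is nonzero. -/
structure IsHilbertSpaceTensorCategory {C : Type*} [Category C] [MonoidalCategory C]
    (For : C ⥤ Hilb.{u}) (τ : Hilb.{u} ⥤ C) : Prop where
  wstar : IsConcreteWStar For
  for_strict : IsStrictMonoidal For
  tau_strict : IsStrictMonoidal τ
  tau_for : τ ⋙ For = 𝟭 Hilb.{u}
  eq_of_id : ∀ (x x' : C) (h : For.obj x = For.obj x') (f : x ⟶ x'),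
    For.map f = eqToHom h → x = x'
  cancel_right : ∀ (x₁ x₂ y : C) (a : For.obj x₁ ⟶ For.obj x₂), Nontrivial (For.obj y) →
    (∃ f : x₁ ⊗ y ⟶ x₂ ⊗ y, HEq (For.map f) (a ▷ For.obj y)) →
    ∃ g : x₁ ⟶ x₂, For.map g = a
  cancel_left : ∀ (x₁ x₂ y : C) (a : For.obj x₁ ⟶ For.obj x₂), Nontrivial (For.obj y) →
    (∃ f : y ⊗ x₁ ⟶ y ⊗ x₂, HEq (For.map f) (For.obj y ◁ a)) →
    ∃ g : x₁ ⟶ x₂, For.map g = a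

/-!
The braiding unitary `Z` of a right representation `S` satisfies `V*₂₃ S₁₂ = S₁₂ V*₂₃ Z₁₃`, and
`H ≠ 0` makes it unique. In this form `Z` is visibly multiplicative in tensor products of
representations and natural for intertwiners. The Yang–Baxter equation and the compatibility of the
braiding with `T` are instances of naturality, since `c_{L,K}` and `T` are themselves intertwiners
between tensor products of right representations.

The operator `T` of a tensor product is the product of `Z₂₃ T¹₁₃ Z₂₃*` and `T²₂₃`. Its equivariance
and its pentagon equation follow from those of `T¹` and `T²`, using naturality of the braiding to
move the factors past each other. Tensoring with the identity of a nonzero Hilbert space is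
injective and `S`, `T` and `Z` are unitary, so `a` is an arrow as soon as `a ⊗ id` or `id ⊗ a` is.
An operator intertwines `X` and `X'` if and only if it intertwines all their slices `(id ⊗ ω)(X)`
and `(id ⊗ ω)(X')`, which is a linear and weakly closed condition.
-/

namespace Hilb

section Insertion

variable {A B C D A' B' C' D' X : Hilb.{u}}

@[simp]
theorem whiskerRight_tmul (f : A ⟶ A') (a : A) (b : B) :
    (f ▷ B).clm (tmul a b) = tmul (f.clm a) b := map_tmul f (𝟙 B) a b

@[simp]
theorem whiskerLeft_tmul (f : B ⟶ B') (a : A) (b : B) :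
    (A ◁ f).clm (tmul a b) = tmul a (f.clm b) := map_tmul (𝟙 A) f a b

@[simp]
theorem associator_hom_tmul (a : A) (b : B) (c : C) :
    (α_ A B C).hom.clm (tmul (tmul a b) c) = tmul a (tmul b c) := assoc_hom_tmul a b c

@[simp]
theorem associator_inv_tmul (a : A) (b : B) (c : C) :
    (α_ A B C).inv.clm (tmul a (tmul b c)) = tmul (tmul a b) c := assoc_inv_tmul a b c

@[simp]
theorem braiding_hom_tmul (a : A) (b : B) : (β_ A B).hom.clm (tmul a b) = tmul b a :=
  flip_hom_tmul a b

/-- Insertion of a vector on the left, `b ↦ a ⊗ b`. Operators on tensor products and their legs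
are determined by their compositions with insertions. -/
noncomputable def insl (B : Hilb.{u}) (a : A) : B ⟶ A ⊗ B := ⟨tmulL A B a⟩

/-- Insertion of a vector on the right, `a ↦ a ⊗ b`. -/
noncomputable def insr (A : Hilb.{u}) (b : B) : A ⟶ A ⊗ B := ⟨(tmulL A B).flip b⟩

@[simp]
theorem insl_apply (a : A) (b : B) : (insl B a).clm b = tmul a b := rfl

@[simp]
theorem insr_apply (a : A) (b : B) : (insr A b).clm a = tmul a b := rfl

theorem ext_tmul {f g : A ⊗ B ⟶ X} (h : ∀ a b, f.clm (tmul a b) = g.clm (tmul a b)) : f = g :=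
  tensor_ext h

theorem ext_insr {f g : A ⊗ B ⟶ X} (h : ∀ b : B, insr A b ≫ f = insr A b ≫ g) : f = g :=
  tensor_ext fun a b => congrArg (fun k : A ⟶ X => k.clm a) (h b)

theorem ext_insr_whiskerRight {f g : (A ⊗ B) ⊗ C ⟶ X}
    (h : ∀ b : B, insr A b ▷ C ≫ f = insr A b ▷ C ≫ g) : f = g :=
  tensor_ext_left fun a b c => by
    simpa using congrArg (fun k : A ⊗ C ⟶ X => k.clm (tmul a c)) (h b)

theorem ext_insl_whiskerRight {f g : (A ⊗ B) ⊗ C ⟶ X}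
    (h : ∀ a : A, insl B a ▷ C ≫ f = insl B a ▷ C ≫ g) : f = g :=
  tensor_ext_left fun a b c => by
    simpa using congrArg (fun k : B ⊗ C ⟶ X => k.clm (tmul b c)) (h a)

theorem ext_insr_whiskerRight_whiskerRight {f g : ((A ⊗ B) ⊗ C) ⊗ D ⟶ X}
    (h : ∀ b : B, insr A b ▷ C ▷ D ≫ f = insr A b ▷ C ▷ D ≫ g) : f = g :=
  tensor_ext_four fun a b c d => by
    simpa using congrArg (fun k : (A ⊗ C) ⊗ D ⟶ X => k.clm (tmul (tmul a c) d)) (h b)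

theorem ext_insl_whiskerRight_whiskerRight {f g : ((A ⊗ B) ⊗ C) ⊗ D ⟶ X}
    (h : ∀ a : A, insl B a ▷ C ▷ D ≫ f = insl B a ▷ C ▷ D ≫ g) : f = g :=
  tensor_ext_four fun a b c d => by
    simpa using congrArg (fun k : (B ⊗ C) ⊗ D ⟶ X => k.clm (tmul (tmul b c) d)) (h a)

theorem insr_whiskerRight (f : A ⟶ A') (b : B) : insr A b ≫ f ▷ B = f ≫ insr A' b := by
  ext a; simp

theorem insr_whiskerLeft (f : B ⟶ B') (b : B) : insr A b ≫ A ◁ f = insr A (f.clm b) := by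
  ext a; simp

theorem insl_whiskerLeft (f : B ⟶ B') (a : A) : insl B a ≫ A ◁ f = f ≫ insl B' a := by
  ext b; simp

theorem insr_braiding (b : B) : insr A b ≫ (β_ A B).hom = insl A b := by
  ext a; simp

theorem insl_associator (a : A) : insl B a ▷ C ≫ (α_ A B C).hom = insl (B ⊗ C) a :=
  ext_tmul fun b c => by simp

theorem insl_associator_inv (a : A) : insl (B ⊗ C) a ≫ (α_ A B C).inv = insl B a ▷ C := by
  rw [Iso.comp_inv_eq, insl_associator]

theorem insr_leg12 (f : A ⊗ B ⟶ A' ⊗ B') (c : C) :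
    insr (A ⊗ B) c ≫ leg12 C f = f ≫ insr (A' ⊗ B') c := insr_whiskerRight f c

theorem insl_leg23 (f : B ⊗ C ⟶ B' ⊗ C') (a : A) :
    insl B a ▷ C ≫ leg23 A f = f ≫ insl B' a ▷ C' := by
  rw [leg23, Category.assoc, reassoc_of% (insl_associator (B := B) (C := C) a),
    reassoc_of% insl_whiskerLeft f a, insl_associator_inv]

theorem insr_whiskerRight_leg23_braiding (b : B) :
    insr A b ▷ C ≫ leg23 A (β_ B C).hom = insr (A ⊗ C) b :=
  ext_tmul fun a c => by simp [leg23]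

theorem insr_leg23_braiding (b : B) : insr (A ⊗ C) b ≫ leg23 A (β_ C B).hom = insr A b ▷ C :=
  ext_tmul fun a c => by simp [leg23]

theorem insr_leg13 (f : A ⊗ C ⟶ A' ⊗ C') (b : B) :
    insr A b ▷ C ≫ leg13 B f = f ≫ insr A' b ▷ C' := by
  rw [leg13, Category.assoc, reassoc_of% (insr_whiskerRight_leg23_braiding (A := A) (C := C) b),
    reassoc_of% insr_leg12 f b, insr_leg23_braiding]

end Insertion

section Functoriality

variable {A B C A' B' C' A'' B'' C'' : Hilb.{u}}

theorem leg12_comp (f : A ⊗ B ⟶ A' ⊗ B') (g : A' ⊗ B' ⟶ A'' ⊗ B'') :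
    leg12 C f ≫ leg12 C g = leg12 C (f ≫ g) := (comp_whiskerRight f g C).symm

theorem leg13_comp (f : A ⊗ C ⟶ A' ⊗ C') (g : A' ⊗ C' ⟶ A'' ⊗ C'') :
    leg13 B f ≫ leg13 B g = leg13 B (f ≫ g) :=
  ext_insr_whiskerRight fun b => by
    rw [reassoc_of% insr_leg13 f b, insr_leg13, insr_leg13, Category.assoc]

theorem leg13_whiskerRight (a : A ⟶ A') : leg13 B (a ▷ C) = a ▷ B ▷ C :=
  ext_insr_whiskerRight fun b => by
    rw [insr_leg13, ← comp_whiskerRight, ← comp_whiskerRight, insr_whiskerRight]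

theorem leg23_whiskerRight (b : B ⟶ B') : leg23 A (b ▷ C) = (A ◁ b) ▷ C :=
  ext_insl_whiskerRight fun a => by
    rw [insl_leg23, ← comp_whiskerRight, ← comp_whiskerRight, insl_whiskerLeft]

theorem whiskerRight_leg23 (a : A ⟶ A') (f : B ⊗ C ⟶ B' ⊗ C') :
    a ▷ B ▷ C ≫ leg23 A' f = leg23 A f ≫ a ▷ B' ▷ C' := by
  simp only [leg23, Category.assoc, ← associator_inv_naturality_left, whisker_exchange_assoc,
    associator_naturality_left_assoc]

theorem whiskerLeft_leg13 (b : B ⟶ B') (f : A ⊗ C ⟶ A' ⊗ C') :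
    (A ◁ b) ▷ C ≫ leg13 B' f = leg13 B f ≫ (A' ◁ b) ▷ C' :=
  ext_insr_whiskerRight fun x => by
    rw [← comp_whiskerRight_assoc, insr_whiskerLeft, insr_leg13, reassoc_of% insr_leg13 f x,
      ← comp_whiskerRight, insr_whiskerLeft]

theorem braiding_leg23 (f : A ⊗ C ⟶ A' ⊗ C') :
    (β_ A B).hom ▷ C ≫ leg23 B f = leg13 B f ≫ (β_ A' B).hom ▷ C' :=
  ext_insr_whiskerRight fun x => by
    rw [← comp_whiskerRight_assoc, insr_braiding, insl_leg23, reassoc_of% insr_leg13 f x,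
      ← comp_whiskerRight, insr_braiding]

theorem braiding_leg13 (f : B ⊗ C ⟶ B' ⊗ C') :
    (β_ A B).hom ▷ C ≫ leg13 A f = leg23 A f ≫ (β_ A B').hom ▷ C' := by
  have h := braiding_leg23 (B := A) f
  rw [← cancel_mono ((β_ B' A).hom ▷ C'), Category.assoc, Category.assoc, ← h,
    ← comp_whiskerRight, ← comp_whiskerRight_assoc, SymmetricCategory.symmetry,
    SymmetricCategory.symmetry, id_whiskerRight, id_whiskerRight, Category.id_comp,
    Category.comp_id]

end Functoriality

section FourLegs

variable {A B C D A' B' C' D' A'' B'' C'' D'' : Hilb.{u}}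

/-- The extension of an operator on the legs 1, 3, 4 to four legs. -/
noncomputable def leg134 (B : Hilb.{u}) (f : (A ⊗ C) ⊗ D ⟶ (A' ⊗ C') ⊗ D') :
    ((A ⊗ B) ⊗ C) ⊗ D ⟶ ((A' ⊗ B) ⊗ C') ⊗ D' :=
  leg23 A' (β_ C' B).hom ▷ D' ∘ₒ leg13 B f ∘ₒ leg23 A (β_ B C).hom ▷ D

/-- The extension of an operator on the legs 2, 3, 4 to four legs. -/
noncomputable def leg234 (A : Hilb.{u}) (f : (B ⊗ C) ⊗ D ⟶ (B' ⊗ C') ⊗ D') :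
    ((A ⊗ B) ⊗ C) ⊗ D ⟶ ((A ⊗ B') ⊗ C') ⊗ D' :=
  (α_ A B' C').inv ▷ D' ∘ₒ leg23 A f ∘ₒ (α_ A B C).hom ▷ D

theorem insr_leg134 (f : (A ⊗ C) ⊗ D ⟶ (A' ⊗ C') ⊗ D') (b : B) :
    insr A b ▷ C ▷ D ≫ leg134 B f = f ≫ insr A' b ▷ C' ▷ D' := by
  rw [leg134, Category.assoc, ← comp_whiskerRight_assoc, insr_whiskerRight_leg23_braiding,
    reassoc_of% insr_leg13 f b, ← comp_whiskerRight, insr_leg23_braiding]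

theorem insl_leg234 (f : (B ⊗ C) ⊗ D ⟶ (B' ⊗ C') ⊗ D') (a : A) :
    insl B a ▷ C ▷ D ≫ leg234 A f = f ≫ insl B' a ▷ C' ▷ D' := by
  rw [leg234, Category.assoc, ← comp_whiskerRight_assoc, insl_associator,
    reassoc_of% insl_leg23 f a, ← comp_whiskerRight, insl_associator_inv]

theorem leg134_comp (f : (A ⊗ C) ⊗ D ⟶ (A' ⊗ C') ⊗ D')
    (g : (A' ⊗ C') ⊗ D' ⟶ (A'' ⊗ C'') ⊗ D'') :
    leg134 B f ≫ leg134 B g = leg134 B (f ≫ g) :=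
  ext_insr_whiskerRight_whiskerRight fun b => by
    rw [reassoc_of% insr_leg134 f b, insr_leg134, insr_leg134, Category.assoc]

theorem leg234_comp (f : (B ⊗ C) ⊗ D ⟶ (B' ⊗ C') ⊗ D')
    (g : (B' ⊗ C') ⊗ D' ⟶ (B'' ⊗ C'') ⊗ D'') :
    leg234 A f ≫ leg234 A g = leg234 A (f ≫ g) :=
  ext_insl_whiskerRight_whiskerRight fun a => by
    rw [reassoc_of% insl_leg234 f a, insl_leg234, insl_leg234, Category.assoc]

theorem leg134_leg12 (f : A ⊗ C ⟶ A' ⊗ C') : leg134 B (leg12 D f) = leg12 D (leg13 B f) :=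
  ext_insr_whiskerRight_whiskerRight fun b => by
    rw [insr_leg134, leg12, leg12, ← comp_whiskerRight, ← comp_whiskerRight, insr_leg13]

theorem leg134_leg13 (f : A ⊗ D ⟶ A' ⊗ D') : leg134 B (leg13 C f) = leg13 C (leg13 B f) :=
  ext_insr_whiskerRight_whiskerRight fun b => by
    rw [insr_leg134, ← leg13_whiskerRight, ← leg13_whiskerRight, leg13_comp, leg13_comp,
      insr_leg13]

theorem leg134_leg23 (f : C ⊗ D ⟶ C' ⊗ D') : leg134 B (leg23 A f) = leg23 (A ⊗ B) f :=
  ext_insr_whiskerRight_whiskerRight fun b => by rw [insr_leg134, whiskerRight_leg23]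

theorem leg234_leg12 (f : B ⊗ C ⟶ B' ⊗ C') : leg234 A (leg12 D f) = leg12 D (leg23 A f) :=
  ext_insl_whiskerRight_whiskerRight fun a => by
    rw [insl_leg234, leg12, leg12, ← comp_whiskerRight, ← comp_whiskerRight, insl_leg23]

theorem leg234_leg13 (f : B ⊗ D ⟶ B' ⊗ D') : leg234 A (leg13 C f) = leg13 C (leg23 A f) :=
  ext_insl_whiskerRight_whiskerRight fun a => by
    rw [insl_leg234, ← leg13_whiskerRight, ← leg13_whiskerRight, leg13_comp, leg13_comp,
      insl_leg23]

theorem leg234_leg23 (f : C ⊗ D ⟶ C' ⊗ D') : leg234 A (leg23 B f) = leg23 (A ⊗ B) f :=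
  ext_insl_whiskerRight_whiskerRight fun a => by rw [insl_leg234, whiskerRight_leg23]

end FourLegs

section DisjointLegs

variable {A B C D A' B' C' D' : Hilb.{u}}

/-- The flip `Σ₂₃` of the last two legs, which carries `leg13` to `leg12`. -/
noncomputable def swap23 (A B C : Hilb.{u}) : (A ⊗ B) ⊗ C ≅ (A ⊗ C) ⊗ B where
  hom := leg23 A (β_ B C).hom
  inv := leg23 A (β_ C B).hom
  hom_inv_id := by rw [leg23_comp, SymmetricCategory.symmetry, leg23_id]
  inv_hom_id := by rw [leg23_comp, SymmetricCategory.symmetry, leg23_id]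

theorem swap23_leg12 (f : A ⊗ C ⟶ A' ⊗ C') :
    (swap23 A B C).hom ≫ leg12 B f = leg13 B f ≫ (swap23 A' B C').hom :=
  (Iso.comp_inv_eq (swap23 A' B C')).1 (Category.assoc _ _ _)

theorem swap23_leg13 (f : A ⊗ B ⟶ A' ⊗ B') :
    (swap23 A B C).hom ≫ leg13 C f = leg12 C f ≫ (swap23 A' B' C).hom :=
  (Iso.eq_inv_comp (swap23 A B C)).1 rfl

theorem swap23_whiskerRight_leg34 (f : B ⊗ D ⟶ B' ⊗ D') :
    (swap23 A B C).hom ▷ D ≫ leg23 (A ⊗ C) f =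
      leg13 C (leg23 A f) ≫ (swap23 A B' C).hom ▷ D' := by
  have h := congrArg (leg234 A) (braiding_leg23 (B := C) f)
  rwa [← leg12, ← leg12, ← leg234_comp, ← leg234_comp, leg234_leg12, leg234_leg23, leg234_leg13,
    leg234_leg12] at h

theorem leg12_comm_leg34 (f : A ⊗ B ⟶ A' ⊗ B') (g : C ⊗ D ⟶ C' ⊗ D') :
    leg12 D (leg12 C f) ≫ leg23 (A' ⊗ B') g = leg23 (A ⊗ B) g ≫ leg12 D' (leg12 C' f) :=
  whiskerRight_leg23 f g

theorem leg13_comm_leg24 (f : A ⊗ C ⟶ A' ⊗ C') (g : B ⊗ D ⟶ B' ⊗ D') :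
    leg12 D (leg13 B f) ≫ leg13 C' (leg23 A' g) =
      leg13 C (leg23 A g) ≫ leg12 D' (leg13 B' f) := by
  rw [← cancel_mono ((swap23 A' B' C').hom ▷ D'), Category.assoc, Category.assoc,
    ← swap23_whiskerRight_leg34, leg12, leg12, ← comp_whiskerRight, ← comp_whiskerRight_assoc,
    ← swap23_leg12, ← swap23_leg12, comp_whiskerRight, comp_whiskerRight, Category.assoc,
    ← reassoc_of% swap23_whiskerRight_leg34 g]
  exact congrArg _ (leg12_comm_leg34 f g)

theorem leg14_comm_leg23 (f : A ⊗ D ⟶ A' ⊗ D') (g : B ⊗ C ⟶ B' ⊗ C') :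
    leg13 C (leg13 B f) ≫ leg12 D' (leg23 A' g) =
      leg12 D (leg23 A g) ≫ leg13 C' (leg13 B' f) := by
  rw [← cancel_epi (swap23 (A ⊗ B) D C).hom, reassoc_of% swap23_leg13 (C := C) (leg13 B f),
    swap23_leg12, reassoc_of% leg13_comm_leg24 f g, ← swap23_leg13,
    reassoc_of% swap23_leg12 (B := D) (leg23 A g)]

end DisjointLegs

section Adjoint

variable {A B C D A' B' C' D' X : Hilb.{u}}

theorem dag_dag (f : A ⟶ B) : dag (dag f) = f :=
  Hom.ext (ContinuousLinearMap.adjoint_adjoint f.clm)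

theorem IsUnitary.dag {f : A ⟶ B} (hf : IsUnitary f) : IsUnitary (dag f) where
  comp_dag := by rw [dag_dag, hf.dag_comp]
  dag_comp := by rw [dag_dag, hf.comp_dag]

theorem IsUnitary.dag_eq {f : A ⟶ B} (hf : IsUnitary f) {g : B ⟶ A} (h : f ≫ g = 𝟙 A) :
    Hilb.dag f = g := by
  rw [← Category.comp_id (Hilb.dag f), ← h, ← Category.assoc, hf.dag_comp, Category.id_comp]

theorem IsUnitary.isIso {f : A ⟶ B} (hf : IsUnitary f) : IsIso f :=
  ⟨Hilb.dag f, hf.comp_dag, hf.dag_comp⟩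

theorem inner_tmul (a a' : A) (b b' : B) :
    inner ℂ (tmul a b) (tmul a' b') = inner ℂ a a' * inner ℂ b b' :=
  ((incl A B).inner_map_map _ _).trans (TensorProduct.inner_tmul _ _ _ _ _)

theorem dag_insr_tmul (b : B) (a : A) (b' : B) :
    (dag (insr A b)).clm (tmul a b') = inner ℂ b b' • a := by
  refine ext_inner_left ℂ fun x => ?_
  rw [inner_smul_right, mul_comm]
  exact (ContinuousLinearMap.adjoint_inner_right (insr A b).clm x (tmul a b')).trans
    (inner_tmul x a b b')

theorem whiskerRight_dag_insr (f : A ⟶ A') (b : B) :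
    f ▷ B ≫ dag (insr A' b) = dag (insr A b) ≫ f :=
  ext_tmul fun a b' => by
    simp only [comp_clm, ContinuousLinearMap.comp_apply, whiskerRight_tmul, dag_insr_tmul,
      map_smul]

theorem ext_dag_insr {f g : X ⟶ A ⊗ B}
    (h : ∀ b : B, f ≫ dag (insr A b) = g ≫ dag (insr A b)) : f = g := by
  have h_dag : dag f = dag g := ext_insr fun b => by
    simpa only [Hilb.dag_comp, dag_dag] using congrArg dag (h b)
  rw [← dag_dag f, h_dag, dag_dag]

theorem dag_whiskerRight (f : A ⟶ A') (B : Hilb.{u}) : dag (f ▷ B) = dag f ▷ B :=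
  ext_insr fun b => by
    rw [insr_whiskerRight, ← dag_dag (insr A' b), ← dag_comp, whiskerRight_dag_insr, dag_comp,
      dag_dag]

theorem dag_braiding (A B : Hilb.{u}) : dag (β_ A B).hom = (β_ B A).hom :=
  (isUnitary_braiding A B).dag_eq (SymmetricCategory.symmetry A B)

theorem dag_associator_hom (A B C : Hilb.{u}) : dag (α_ A B C).hom = (α_ A B C).inv :=
  (isUnitary_isoOfIsometry _ : IsUnitary (α_ A B C).hom).dag_eq (α_ A B C).hom_inv_id

theorem dag_associator_inv (A B C : Hilb.{u}) : dag (α_ A B C).inv = (α_ A B C).hom := by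
  rw [← dag_associator_hom, dag_dag]

theorem whiskerLeft_eq_braiding (A : Hilb.{u}) (f : B ⟶ B') :
    A ◁ f = (β_ A B).hom ≫ f ▷ A ≫ (β_ B' A).hom := by
  rw [← BraidedCategory.braiding_naturality_right_assoc, SymmetricCategory.symmetry,
    Category.comp_id]

theorem dag_whiskerLeft (A : Hilb.{u}) (f : B ⟶ B') : dag (A ◁ f) = A ◁ dag f := by
  simp only [whiskerLeft_eq_braiding, dag_comp, dag_whiskerRight, dag_braiding, Category.assoc]

theorem dag_leg12 (f : A ⊗ B ⟶ A' ⊗ B') : dag (leg12 C f) = leg12 C (dag f) :=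
  dag_whiskerRight f C

theorem dag_leg23 (f : B ⊗ C ⟶ B' ⊗ C') : dag (leg23 A f) = leg23 A (dag f) := by
  simp only [leg23, dag_comp, dag_associator_hom, dag_associator_inv, dag_whiskerLeft,
    Category.assoc]

theorem dag_leg13 (f : A ⊗ C ⟶ A' ⊗ C') : dag (leg13 B f) = leg13 B (dag f) := by
  simp only [leg13, dag_comp, dag_leg12, dag_leg23, dag_braiding, Category.assoc]

theorem dag_leg134 (f : (A ⊗ C) ⊗ D ⟶ (A' ⊗ C') ⊗ D') :
    dag (leg134 B f) = leg134 B (dag f) := by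
  simp only [leg134, dag_comp, dag_whiskerRight, dag_leg13, dag_leg23, dag_braiding,
    Category.assoc]

theorem dag_leg234 (f : (B ⊗ C) ⊗ D ⟶ (B' ⊗ C') ⊗ D') :
    dag (leg234 A f) = leg234 A (dag f) := by
  simp only [leg234, dag_comp, dag_whiskerRight, dag_leg23, dag_associator_hom,
    dag_associator_inv, Category.assoc]

theorem IsUnitary.leg12 {f : A ⊗ B ⟶ A' ⊗ B'} (hf : IsUnitary f) :
    IsUnitary (Hilb.leg12 C f) where
  comp_dag := by rw [dag_leg12, leg12_comp, hf.comp_dag, leg12_id]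
  dag_comp := by rw [dag_leg12, leg12_comp, hf.dag_comp, leg12_id]

theorem IsUnitary.leg13 {f : A ⊗ C ⟶ A' ⊗ C'} (hf : IsUnitary f) :
    IsUnitary (Hilb.leg13 B f) where
  comp_dag := by rw [dag_leg13, leg13_comp, hf.comp_dag, leg13_id]
  dag_comp := by rw [dag_leg13, leg13_comp, hf.dag_comp, leg13_id]

theorem IsUnitary.leg23 {f : B ⊗ C ⟶ B' ⊗ C'} (hf : IsUnitary f) :
    IsUnitary (Hilb.leg23 A f) where
  comp_dag := by rw [dag_leg23, leg23_comp, hf.comp_dag, leg23_id]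
  dag_comp := by rw [dag_leg23, leg23_comp, hf.dag_comp, leg23_id]

end Adjoint

section Injectivity

variable {A B C D A' B' C' D' : Hilb.{u}}

theorem exists_retraction_insr [Nontrivial B] :
    ∃ b : B, ∀ A : Hilb.{u}, ∃ r : A ⊗ B ⟶ A, insr A b ≫ r = 𝟙 A := by
  obtain ⟨b, hb⟩ := exists_ne (0 : B)
  refine ⟨b, fun A => ⟨⟨(inner ℂ b b)⁻¹ • (dag (insr A b)).clm⟩, ?_⟩⟩
  ext a
  change (inner ℂ b b)⁻¹ • (dag (insr A b)).clm (tmul a b) = a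
  rw [dag_insr_tmul, smul_smul, inv_mul_cancel₀ (inner_self_ne_zero.mpr hb), one_smul]

variable [Nontrivial B]

theorem leg13_injective : Function.Injective (leg13 B : (A ⊗ C ⟶ A' ⊗ C') → _) := by
  intro f g h
  obtain ⟨b, hb⟩ := exists_retraction_insr (B := B)
  obtain ⟨r, hr⟩ := hb A'
  have hfg : f ≫ insr A' b ▷ C' = g ≫ insr A' b ▷ C' := by
    rw [← insr_leg13, h, insr_leg13]
  simpa only [Category.assoc, ← comp_whiskerRight, hr, id_whiskerRight, Category.comp_id] using
    congrArg (· ≫ r ▷ C') hfg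

theorem leg23_injective : Function.Injective (leg23 B : (A ⊗ C ⟶ A' ⊗ C') → _) := by
  intro f g h
  refine leg13_injective (B := B) ?_
  rw [← cancel_mono ((β_ A' B).hom ▷ C'), ← braiding_leg23, ← braiding_leg23, h]

theorem leg134_injective :
    Function.Injective (leg134 B : ((A ⊗ C) ⊗ D ⟶ (A' ⊗ C') ⊗ D') → _) := by
  intro f g h
  obtain ⟨b, hb⟩ := exists_retraction_insr (B := B)
  obtain ⟨r, hr⟩ := hb A'
  have hfg : f ≫ insr A' b ▷ C' ▷ D' = g ≫ insr A' b ▷ C' ▷ D' := by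
    rw [← insr_leg134, h, insr_leg134]
  simpa only [Category.assoc, ← comp_whiskerRight, hr, id_whiskerRight, Category.comp_id] using
    congrArg (· ≫ r ▷ C' ▷ D') hfg

end Injectivity

section UnitaryGroup

variable {A B C D : Hilb.{u}}

/-- The adjoint as star operation, so that `unitary (End A)` is the unitary group of `A`. -/
noncomputable instance : StarMul (End A) where
  star f := dag f
  star_involutive := dag_dag
  star_mul f g := dag_comp g f

instance : CanLift (A ⟶ A) (unitary (End A)) Subtype.val IsUnitary where
  prf f hf := ⟨⟨f, Unitary.mem_iff.2 ⟨hf.comp_dag, hf.dag_comp⟩⟩, rfl⟩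

theorem isUnitary_coe (f : unitary (End A)) : IsUnitary (A := A) f.1 :=
  ⟨Unitary.coe_star_mul_self f, Unitary.coe_mul_star_self f⟩

/-- The leg numbering `f ↦ f₁₂` as a homomorphism of unitary groups. -/
noncomputable def uleg12 (C : Hilb.{u}) :
    unitary (End (A ⊗ B)) →⋆* unitary (End ((A ⊗ B) ⊗ C)) :=
  Unitary.map
    { toFun := fun f => leg12 C f
      map_one' := leg12_id
      map_mul' := fun f g => (leg12_comp g f).symm
      map_star' := fun f => (dag_leg12 f).symm }

/-- The leg numbering `f ↦ f₁₃` as a homomorphism of unitary groups. -/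
noncomputable def uleg13 (B : Hilb.{u}) :
    unitary (End (A ⊗ C)) →⋆* unitary (End ((A ⊗ B) ⊗ C)) :=
  Unitary.map
    { toFun := fun f => leg13 B f
      map_one' := leg13_id
      map_mul' := fun f g => (leg13_comp g f).symm
      map_star' := fun f => (dag_leg13 f).symm }

/-- The leg numbering `f ↦ f₂₃` as a homomorphism of unitary groups. -/
noncomputable def uleg23 (A : Hilb.{u}) :
    unitary (End (B ⊗ C)) →⋆* unitary (End ((A ⊗ B) ⊗ C)) :=
  Unitary.map
    { toFun := fun f => leg23 A f
      map_one' := leg23_id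
      map_mul' := fun f g => (leg23_comp g f).symm
      map_star' := fun f => (dag_leg23 f).symm }

/-- The leg numbering `f ↦ f₁₃₄` as a homomorphism of unitary groups. -/
noncomputable def uleg134 (B : Hilb.{u}) :
    unitary (End ((A ⊗ C) ⊗ D)) →⋆* unitary (End (((A ⊗ B) ⊗ C) ⊗ D)) :=
  Unitary.map
    { toFun := fun f => leg134 B f
      map_one' := by
        rw [End.one_def, ← leg12_id, leg134_leg12, leg13_id, leg12_id, End.one_def]
      map_mul' := fun f g => (leg134_comp g f).symm
      map_star' := fun f => (dag_leg134 f).symm }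

/-- The leg numbering `f ↦ f₂₃₄` as a homomorphism of unitary groups. -/
noncomputable def uleg234 (A : Hilb.{u}) :
    unitary (End ((B ⊗ C) ⊗ D)) →⋆* unitary (End (((A ⊗ B) ⊗ C) ⊗ D)) :=
  Unitary.map
    { toFun := fun f => leg234 A f
      map_one' := by
        rw [End.one_def, ← leg12_id, leg234_leg12, leg23_id, leg12_id, End.one_def]
      map_mul' := fun f g => (leg234_comp g f).symm
      map_star' := fun f => (dag_leg234 f).symm }

theorem uleg134_injective [Nontrivial B] :
    Function.Injective (uleg134 B : unitary (End ((A ⊗ C) ⊗ D)) → _) :=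
  Unitary.map_injective leg134_injective

theorem uleg134_uleg12 (f : unitary (End (A ⊗ C))) :
    uleg134 B (uleg12 D f) = uleg12 D (uleg13 B f) := Subtype.ext (leg134_leg12 _)

theorem uleg134_uleg13 (f : unitary (End (A ⊗ D))) :
    uleg134 B (uleg13 C f) = uleg13 C (uleg13 B f) := Subtype.ext (leg134_leg13 _)

theorem uleg134_uleg23 (f : unitary (End (C ⊗ D))) :
    uleg134 B (uleg23 A f) = uleg23 (A ⊗ B) f := Subtype.ext (leg134_leg23 _)

theorem uleg234_uleg12 (f : unitary (End (B ⊗ C))) :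
    uleg234 A (uleg12 D f) = uleg12 D (uleg23 A f) := Subtype.ext (leg234_leg12 _)

theorem uleg234_uleg13 (f : unitary (End (B ⊗ D))) :
    uleg234 A (uleg13 C f) = uleg13 C (uleg23 A f) := Subtype.ext (leg234_leg13 _)

theorem uleg234_uleg23 (f : unitary (End (C ⊗ D))) :
    uleg234 A (uleg23 B f) = uleg23 (A ⊗ B) f := Subtype.ext (leg234_leg23 _)

theorem uleg13_uleg12 (f : unitary (End (A ⊗ B))) :
    uleg13 C (uleg12 D f) = uleg12 D (uleg12 C f) := Subtype.ext (leg13_whiskerRight _)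

theorem commute_uleg12_uleg34 (f : unitary (End (A ⊗ B))) (g : unitary (End (C ⊗ D))) :
    Commute (uleg12 D (uleg12 C f)) (uleg23 (A ⊗ B) g) :=
  Subtype.ext (leg12_comm_leg34 (A := A) (A' := A) f.1 g.1).symm

theorem commute_uleg13_uleg24 (f : unitary (End (A ⊗ C))) (g : unitary (End (B ⊗ D))) :
    Commute (uleg12 D (uleg13 B f)) (uleg13 C (uleg23 A g)) :=
  Subtype.ext (leg13_comm_leg24 (A := A) (A' := A) f.1 g.1).symm

theorem commute_uleg14_uleg23 (f : unitary (End (A ⊗ D))) (g : unitary (End (B ⊗ C))) :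
    Commute (uleg13 C (uleg13 B f)) (uleg12 D (uleg23 A g)) :=
  Subtype.ext (leg14_comm_leg23 (A := A) (A' := A) f.1 g.1).symm

end UnitaryGroup

section Intertwines

variable {A A' A'' B B' C D : Hilb.{u}}

/-- The operator `a` intertwines `X` and `X'` on the first leg: `a₁ X = X' a₁`. Arrows of
representations, equivariance of operators on tensor products, and naturality of the braiding
are all of this form. -/
def Intertwines (a : A ⟶ A') (X : A ⊗ C ⟶ A ⊗ C) (X' : A' ⊗ C ⟶ A' ⊗ C) : Prop :=
  X ≫ a ▷ C = a ▷ C ≫ X'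

namespace Intertwines

variable {a : A ⟶ A'} {b : B ⟶ B'} {X Y : A ⊗ C ⟶ A ⊗ C} {X' Y' : A' ⊗ C ⟶ A' ⊗ C}
  {X'' : A'' ⊗ C ⟶ A'' ⊗ C}

theorem trans {a' : A' ⟶ A''} (h : Intertwines a X X') (h' : Intertwines a' X' X'') :
    Intertwines (a ≫ a') X X'' := by
  rw [Intertwines, comp_whiskerRight, reassoc_of% h, h', Category.assoc]

theorem inv {e : A ≅ A'} (h : Intertwines e.hom X X') : Intertwines e.inv X' X := by
  rw [Intertwines, ← cancel_epi (e.hom ▷ C), ← reassoc_of% h, hom_inv_whiskerRight,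
    hom_inv_whiskerRight_assoc, Category.comp_id]

theorem comp (h : Intertwines a X X') (h' : Intertwines a Y Y') :
    Intertwines a (X ≫ Y) (X' ≫ Y') := by
  rw [Intertwines, Category.assoc, h', reassoc_of% h]

theorem comp_iff_right (hX : IsUnitary X) (h : Intertwines a X X') :
    Intertwines a (X ≫ Y) (X' ≫ Y') ↔ Intertwines a Y Y' := by
  have := hX.isIso
  rw [Intertwines, Category.assoc, ← reassoc_of% h, cancel_epi, Intertwines]

theorem comp_iff_left (hY' : IsUnitary Y') (h : Intertwines a Y Y') :
    Intertwines a (X ≫ Y) (X' ≫ Y') ↔ Intertwines a X X' := by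
  have := hY'.isIso
  rw [Intertwines, Category.assoc, h, ← Category.assoc, ← Category.assoc, cancel_mono,
    Intertwines]

theorem dag_operators (hX : IsUnitary X) (hX' : IsUnitary X') (h : Intertwines a X X') :
    Intertwines a (dag X) (dag X') := by
  have := hX.isIso
  rw [Intertwines, ← cancel_epi X, reassoc_of% hX.comp_dag, reassoc_of% h, hX'.comp_dag,
    Category.comp_id]

theorem adjoint (hX : IsUnitary X) (hX' : IsUnitary X') (h : Intertwines a X X') :
    Intertwines (dag a) X' X := by
  have h' := congrArg dag (h.dag_operators hX hX')
  rw [Hilb.dag_comp, Hilb.dag_comp, dag_dag, dag_dag, dag_whiskerRight] at h'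
  exact h'.symm

theorem leg12 (h : Intertwines a X X') (D : Hilb.{u}) :
    Intertwines (a ▷ C) (leg12 D X) (leg12 D X') := by
  rw [Intertwines, Hilb.leg12, Hilb.leg12, ← comp_whiskerRight, h, comp_whiskerRight]

theorem leg13 (h : Intertwines a X X') (B : Hilb.{u}) :
    Intertwines (a ▷ B) (leg13 B X) (leg13 B X') := by
  rw [Intertwines, ← leg13_whiskerRight, leg13_comp, h, leg13_comp]

theorem leg13_iff [Nontrivial B] :
    Intertwines (a ▷ B) (Hilb.leg13 B X) (Hilb.leg13 B X') ↔ Intertwines a X X' := by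
  rw [Intertwines, ← leg13_whiskerRight, leg13_comp, leg13_comp, leg13_injective.eq_iff,
    Intertwines]

theorem leg23_whiskerRight (a : A ⟶ A') (Z : B ⊗ C ⟶ B ⊗ C) :
    Intertwines (a ▷ B) (leg23 A Z) (leg23 A' Z) :=
  (whiskerRight_leg23 a Z).symm

theorem leg23 {Z : B ⊗ C ⟶ B ⊗ C} {Z' : B' ⊗ C ⟶ B' ⊗ C} (h : Intertwines b Z Z')
    (A : Hilb.{u}) : Intertwines (A ◁ b) (leg23 A Z) (leg23 A Z') := by
  rw [Intertwines, ← Hilb.leg23_whiskerRight, leg23_comp, h, leg23_comp]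

theorem leg23_iff [Nontrivial A] {Z : B ⊗ C ⟶ B ⊗ C} {Z' : B' ⊗ C ⟶ B' ⊗ C} :
    Intertwines (A ◁ b) (Hilb.leg23 A Z) (Hilb.leg23 A Z') ↔ Intertwines b Z Z' := by
  rw [Intertwines, ← Hilb.leg23_whiskerRight, leg23_comp, leg23_comp, leg23_injective.eq_iff,
    Intertwines]

theorem leg13_whiskerLeft (b : B ⟶ B') (X : A ⊗ C ⟶ A ⊗ C) :
    Intertwines (A ◁ b) (Hilb.leg13 B X) (Hilb.leg13 B' X) :=
  (whiskerLeft_leg13 b X).symm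

theorem braiding_leg13 (X : A ⊗ C ⟶ A ⊗ C) :
    Intertwines (β_ A B).hom (Hilb.leg13 B X) (Hilb.leg23 B X) :=
  (braiding_leg23 X).symm

theorem braiding_leg23 (X : A ⊗ C ⟶ A ⊗ C) :
    Intertwines (β_ B A).hom (Hilb.leg23 B X) (Hilb.leg13 B X) :=
  (Hilb.braiding_leg13 X).symm

theorem associator_leg14 (X : A ⊗ C ⟶ A ⊗ C) :
    Intertwines (α_ A B D).hom (Hilb.leg13 D (Hilb.leg13 B X)) (Hilb.leg13 (B ⊗ D) X) := by
  have insr_associator (A' C' : Hilb.{u}) (b : B) (d : D) :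
      insr A' b ▷ C' ≫ insr (A' ⊗ B) d ▷ C' ≫ (α_ A' B D).hom ▷ C' =
        insr A' (tmul b d) ▷ C' := by
    rw [← comp_whiskerRight, ← comp_whiskerRight]
    congr 1
    ext
    simp
  refine ext_insr_whiskerRight fun d => ext_insr_whiskerRight fun b => ?_
  rw [reassoc_of% insr_leg13 (Hilb.leg13 B X) d, reassoc_of% insr_leg13 X b, insr_associator,
    reassoc_of% insr_associator A C b d]
  exact (insr_leg13 X (tmul b d)).symm

theorem associator_leg24 (A : Hilb.{u}) (Z : B ⊗ C ⟶ B ⊗ C) :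
    Intertwines (α_ A B D).hom (Hilb.leg13 D (Hilb.leg23 A Z)) (Hilb.leg23 A (Hilb.leg13 D Z)) := by
  rw [← leg234_leg13, leg234, Intertwines]
  simp

theorem associator_leg34 (A B : Hilb.{u}) (Z : D ⊗ C ⟶ D ⊗ C) :
    Intertwines (α_ A B D).hom (Hilb.leg23 (A ⊗ B) Z) (Hilb.leg23 A (Hilb.leg23 B Z)) := by
  rw [← leg234_leg23, leg234, Intertwines]
  simp

theorem leftUnitor (X : A ⊗ C ⟶ A ⊗ C) :
    Intertwines (λ_ A).hom (Hilb.leg23 (𝟙_ Hilb.{u}) X) X := by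
  simp [Intertwines, Hilb.leg23]

theorem rightUnitor (X : A ⊗ C ⟶ A ⊗ C) :
    Intertwines (ρ_ A).hom (Hilb.leg13 (𝟙_ Hilb.{u}) X) X := by
  rw [← braiding_leftUnitor]
  exact (braiding_leg13 X).trans (leftUnitor X)

end Intertwines

theorem intertwines_id_iff {X X' : A ⊗ C ⟶ A ⊗ C} : Intertwines (𝟙 A) X X' ↔ X = X' := by
  rw [Intertwines, id_whiskerRight, Category.comp_id, Category.id_comp]

end Intertwines

section TensorS

variable {H K K₁ K₁' K₂ K₂' K₃ : Hilb.{u}} {W : H ⊗ H ⟶ H ⊗ H}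
  {S₁ : K₁ ⊗ H ⟶ K₁ ⊗ H} {S₁' : K₁' ⊗ H ⟶ K₁' ⊗ H}
  {S₂ : K₂ ⊗ H ⟶ K₂ ⊗ H} {S₂' : K₂' ⊗ H ⟶ K₂' ⊗ H}

theorem IsUnitary.tensorS (h₁ : IsUnitary S₁) (h₂ : IsUnitary S₂) :
    IsUnitary (tensorS S₁ S₂) :=
  h₂.leg23.comp h₁.leg13

theorem tensorS_id_left (S₂ : K₂ ⊗ H ⟶ K₂ ⊗ H) : tensorS (𝟙 (K ⊗ H)) S₂ = leg23 K S₂ := by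
  rw [tensorS, leg13_id, Category.comp_id]

theorem IsRightRep.tensorS (h₁ : IsRightRep W S₁) (h₂ : IsRightRep W S₂) :
    IsRightRep W (tensorS S₁ S₂) where
  unitary := h₁.unitary.tensorS h₂.unitary
  rep := by
    have e₁ := congrArg (leg134 K₂) h₁.rep
    have e₂ := congrArg (leg234 K₁) h₂.rep
    simp only [← leg134_comp, ← leg234_comp, leg134_leg12, leg134_leg13, leg134_leg23,
      leg234_leg12, leg234_leg13, leg234_leg23, Category.assoc] at e₁ e₂
    simp only [Hilb.tensorS, ← leg12_comp, ← leg13_comp, Category.assoc]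
    rw [e₁, reassoc_of% e₂, reassoc_of% leg14_comm_leg23 S₁ S₂]

namespace Intertwines

variable {a : K₁ ⟶ K₁'} {b : K₂ ⟶ K₂'}

theorem tensorS_whiskerRight (h : Intertwines a S₁ S₁') (S₂ : K₂ ⊗ H ⟶ K₂ ⊗ H) :
    Intertwines (a ▷ K₂) (tensorS S₁ S₂) (tensorS S₁' S₂) :=
  (leg23_whiskerRight a S₂).comp (h.leg13 K₂)

theorem tensorS_whiskerLeft (h : Intertwines b S₂ S₂') (S₁ : K₁ ⊗ H ⟶ K₁ ⊗ H) :
    Intertwines (K₁ ◁ b) (tensorS S₁ S₂) (tensorS S₁ S₂') :=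
  (h.leg23 K₁).comp (leg13_whiskerLeft b S₁)

theorem tensorS_whiskerRight_iff [Nontrivial K₂] (hS₂ : IsUnitary S₂) :
    Intertwines (a ▷ K₂) (tensorS S₁ S₂) (tensorS S₁' S₂) ↔ Intertwines a S₁ S₁' :=
  (comp_iff_right hS₂.leg23 (leg23_whiskerRight a S₂)).trans leg13_iff

theorem tensorS_whiskerLeft_iff [Nontrivial K₁] (hS₁ : IsUnitary S₁) :
    Intertwines (K₁ ◁ b) (tensorS S₁ S₂) (tensorS S₁ S₂') ↔ Intertwines b S₂ S₂' :=
  (comp_iff_left hS₁.leg13 (leg13_whiskerLeft b S₁)).trans leg23_iff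

theorem tensorS_associator (S₁ : K₁ ⊗ H ⟶ K₁ ⊗ H) (S₂ : K₂ ⊗ H ⟶ K₂ ⊗ H)
    (S₃ : K₃ ⊗ H ⟶ K₃ ⊗ H) :
    Intertwines (α_ K₁ K₂ K₃).hom (tensorS (tensorS S₁ S₂) S₃) (tensorS S₁ (tensorS S₂ S₃)) := by
  simp only [tensorS, ← leg13_comp, ← leg23_comp, Category.assoc]
  exact (associator_leg34 K₁ K₂ S₃).comp
    ((associator_leg24 K₁ S₂).comp (associator_leg14 S₁))

theorem tensorS_leftUnitor (S₂ : K₂ ⊗ H ⟶ K₂ ⊗ H) :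
    Intertwines (λ_ K₂).hom (tensorS (𝟙 (𝟙_ Hilb.{u} ⊗ H : Hilb.{u})) S₂) S₂ := by
  rw [tensorS_id_left]
  exact .leftUnitor S₂

theorem tensorS_rightUnitor (S₁ : K₁ ⊗ H ⟶ K₁ ⊗ H) :
    Intertwines (ρ_ K₁).hom (tensorS S₁ (𝟙 (𝟙_ Hilb.{u} ⊗ H : Hilb.{u}))) S₁ := by
  rw [tensorS, leg23_id, Category.id_comp]
  exact .rightUnitor S₁

theorem leg23_tensorS {B B' C C' : Hilb.{u}} {SB : B ⊗ H ⟶ B ⊗ H} {SC : C ⊗ H ⟶ C ⊗ H}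
    {SB' : B' ⊗ H ⟶ B' ⊗ H} {SC' : C' ⊗ H ⟶ C' ⊗ H} {f : B ⊗ C ⟶ B' ⊗ C'}
    (h : Intertwines f (tensorS SB SC) (tensorS SB' SC')) (S₁ : K₁ ⊗ H ⟶ K₁ ⊗ H) :
    Intertwines (Hilb.leg23 K₁ f) (tensorS (tensorS S₁ SB) SC) (tensorS (tensorS S₁ SB') SC') :=
  ((tensorS_associator S₁ SB SC).trans (h.tensorS_whiskerLeft S₁)).trans
    (tensorS_associator S₁ SB' SC').inv

end Intertwines

end TensorS

theorem commutator_comm_of_drinfeld {G : Type*} [Group G] {s s' u v w z : G}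
    (hs : w * s = s * (s' * w)) (drinfeld : u * (w * v) = v * (w * u))
    (hz : v⁻¹ * s = s * (v⁻¹ * z)) (s'_v : Commute s' v) (z_w : Commute z w)
    (s_u : Commute s u) : z * (u * s') = s' * u * z := by
  have drinfeld' : v⁻¹ * (u * w) = w * (u * v⁻¹) := by
    rw [inv_mul_eq_iff_eq_mul, ← mul_assoc, ← mul_assoc, eq_mul_inv_iff_mul_eq]
    simpa only [mul_assoc] using drinfeld
  refine mul_left_cancel (a := s * v⁻¹) (mul_right_cancel (b := w) ?_)
  calc s * v⁻¹ * (z * (u * s')) * w = s * (v⁻¹ * z) * (u * s' * w) := by simp only [mul_assoc]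
    _ = v⁻¹ * (s * u) * (s' * w) := by rw [← hz]; simp only [mul_assoc]
    _ = v⁻¹ * u * (s * (s' * w)) := by rw [s_u.eq]; simp only [mul_assoc]
    _ = v⁻¹ * (u * w) * s := by rw [← hs]; simp only [mul_assoc]
    _ = w * u * (v⁻¹ * s) := by rw [drinfeld']; simp only [mul_assoc]
    _ = w * (u * s) * (v⁻¹ * z) := by rw [hz]; simp only [mul_assoc]
    _ = w * s * (u * (v⁻¹ * z)) := by rw [← s_u.eq]; simp only [mul_assoc]
    _ = s * s' * (w * (u * v⁻¹)) * z := by rw [hs]; simp only [mul_assoc]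
    _ = s * (s' * v⁻¹) * (u * (w * z)) := by rw [← drinfeld']; simp only [mul_assoc]
    _ = s * v⁻¹ * (s' * u * z) * w := by
      rw [s'_v.inv_right.eq, ← z_w.eq]; simp only [mul_assoc]

section Braiding

variable {H L K K' K₁ K₂ : Hilb.{u}} {W : H ⊗ H ⟶ H ⊗ H} {V : H ⊗ L ⟶ H ⊗ L}
  {S : K ⊗ H ⟶ K ⊗ H} {S' : K' ⊗ H ⟶ K' ⊗ H} {Z : K ⊗ L ⟶ K ⊗ L} {Z' : K' ⊗ L ⟶ K' ⊗ L}

theorem isBraidingUnitary_iff (hV : IsUnitary V) (hS : IsUnitary S) (hZ : IsUnitary Z) :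
    IsBraidingUnitary V S Z ↔
      leg23 K (dag V) ∘ₒ leg12 L S = leg12 L S ∘ₒ leg23 K (dag V) ∘ₒ leg13 H Z := by
  lift V to unitary (End (H ⊗ L)) using hV
  lift S to unitary (End (K ⊗ H)) using hS
  lift Z to unitary (End (K ⊗ L)) using hZ
  have eq_iff {G : Type u} [Group G] (v s z : G) :
      z = v * (s⁻¹ * (v⁻¹ * s)) ↔ v⁻¹ * s = s * (v⁻¹ * z) := by
    constructor <;> intro h <;> simp [h]
  have key := eq_iff (uleg23 K V) (uleg12 L S) (uleg13 H Z)
  rw [← map_inv, ← map_inv] at key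
  exact ⟨fun h => congrArg Subtype.val (key.1 (Subtype.ext h.eq)),
    fun h => ⟨isUnitary_coe Z, congrArg Subtype.val (key.2 (Subtype.ext h))⟩⟩

theorem IsBraidingUnitary.tensorS {S₁ : K₁ ⊗ H ⟶ K₁ ⊗ H} {S₂ : K₂ ⊗ H ⟶ K₂ ⊗ H}
    {Z₁ : K₁ ⊗ L ⟶ K₁ ⊗ L} {Z₂ : K₂ ⊗ L ⟶ K₂ ⊗ L} (hV : IsUnitary V) (hS₁ : IsUnitary S₁)
    (hS₂ : IsUnitary S₂) (h₁ : IsBraidingUnitary V S₁ Z₁) (h₂ : IsBraidingUnitary V S₂ Z₂) :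
    IsBraidingUnitary V (tensorS S₁ S₂) (leg23 K₁ Z₂ ∘ₒ leg13 K₂ Z₁) := by
  rw [isBraidingUnitary_iff hV (hS₁.tensorS hS₂) (h₁.unitary.leg13.comp h₂.unitary.leg23)]
  have e₁ := congrArg (leg134 K₂) ((isBraidingUnitary_iff hV hS₁ h₁.unitary).1 h₁)
  have e₂ := congrArg (leg234 K₁) ((isBraidingUnitary_iff hV hS₂ h₂.unitary).1 h₂)
  simp only [← leg134_comp, ← leg234_comp, leg134_leg12, leg134_leg13, leg134_leg23,
    leg234_leg12, leg234_leg13, leg234_leg23, Category.assoc] at e₁ e₂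
  simp only [Hilb.tensorS, ← leg12_comp, ← leg13_comp, Category.assoc]
  rw [e₁, ← reassoc_of% leg14_comm_leg23 Z₁ S₂, reassoc_of% e₂]

theorem IsBraidingUnitary.unique [Nontrivial H] {Z₀ : K ⊗ L ⟶ K ⊗ L}
    (h : IsBraidingUnitary V S Z) (h₀ : IsBraidingUnitary V S Z₀) : Z = Z₀ :=
  leg13_injective (h.eq.trans h₀.eq.symm)

theorem IsBraidingUnitary.braidZ_eq [Nontrivial H] (h : IsBraidingUnitary V S Z) :
    braidZ V S = Z :=
  (braidZ_spec ⟨Z, h⟩).unique h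

theorem isBraidingUnitary_id (hV : IsUnitary V) (K : Hilb.{u}) :
    IsBraidingUnitary V (𝟙 (K ⊗ H)) (𝟙 (K ⊗ L)) := by
  rw [isBraidingUnitary_iff hV (isUnitary_id _) (isUnitary_id _), leg12_id, leg13_id]
  simp

theorem Intertwines.braiding [Nontrivial H] {a : K ⟶ K'} (h : Intertwines a S S')
    (hS : IsUnitary S) (hS' : IsUnitary S') (hZ : IsBraidingUnitary V S Z)
    (hZ' : IsBraidingUnitary V S' Z') : Intertwines a Z Z' := by
  rw [← leg13_iff (B := H), hZ.eq, hZ'.eq]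
  exact (((h.leg12 L).comp (leg23_whiskerRight a (dag V))).comp
    ((h.dag_operators hS hS').leg12 L)).comp (leg23_whiskerRight a V)

theorem intertwines_braidingUnitary [Nontrivial H] {U : L ⊗ H ⟶ L ⊗ H} (hW : IsUnitary W)
    (hU : IsUnitary U) (hV : IsUnitary V) (hS : IsRightRep W S)
    (drinfeld : leg23 H U ∘ₒ leg13 L W ∘ₒ leg12 H V = leg12 H V ∘ₒ leg13 L W ∘ₒ leg23 H U)
    (hZ : IsBraidingUnitary V S Z) :
    Intertwines Z (leg13 L S ≫ leg23 K U) (tensorS S U) := by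
  have hZ_eq := (isBraidingUnitary_iff hV hS.unitary hZ.unitary).1 hZ
  lift V to unitary (End (H ⊗ L)) using hV
  obtain ⟨hS, hS_eq⟩ := hS
  lift S to unitary (End (K ⊗ H)) using hS
  obtain ⟨hZ, -⟩ := hZ
  lift Z to unitary (End (K ⊗ L)) using hZ
  lift W to unitary (End (H ⊗ H)) using hW
  lift U to unitary (End (L ⊗ H)) using hU
  have e₁ : uleg23 K W * uleg12 H S = uleg12 H S * (uleg13 H S * uleg23 K W) :=
    Subtype.ext hS_eq
  have e₂ : uleg23 H U * (uleg13 L W * uleg12 H V) = uleg12 H V * (uleg13 L W * uleg23 H U) :=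
    Subtype.ext drinfeld
  have e₃ : uleg23 K V⁻¹ * uleg12 L S = uleg12 L S * (uleg23 K V⁻¹ * uleg13 H Z) :=
    Subtype.ext hZ_eq
  replace e₁ := congrArg (uleg13 L) e₁
  replace e₂ := congrArg (uleg234 K) e₂
  replace e₃ := congrArg (uleg12 H) e₃
  simp only [map_mul, map_inv, uleg13_uleg12, uleg234_uleg12, uleg234_uleg13, uleg234_uleg23]
    at e₁ e₂ e₃
  suffices uleg12 H Z * (uleg23 K U * uleg13 L S) = uleg13 L S * uleg23 K U * uleg12 H Z from
    congrArg Subtype.val this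
  refine uleg134_injective (B := H) ?_
  simp only [map_mul, uleg134_uleg12, uleg134_uleg13, uleg134_uleg23]
  exact commutator_comm_of_drinfeld e₁ e₂ e₃ (commute_uleg14_uleg23 S V)
    (commute_uleg13_uleg24 Z W) (commute_uleg12_uleg34 S U)

end Braiding

theorem commute_mul_of_commute_mul {G : Type*} [Group G] {f s v v' z z' : G}
    (hz : v⁻¹ * s = s * (v⁻¹ * z)) (hz' : v'⁻¹ * s = s * (v'⁻¹ * z')) (z_v' : Commute z v')
    (f_v : Commute f (v' * v)) (f_s : Commute f s) : Commute f (z * z') := by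
  have z_mul_z' : z * z' = (s * (v' * v)⁻¹)⁻¹ * ((v' * v)⁻¹ * s) := by
    rw [eq_inv_mul_iff_mul_eq]
    calc s * (v' * v)⁻¹ * (z * z') = s * (v⁻¹ * (v'⁻¹ * z)) * z' := by
          simp only [mul_inv_rev, mul_assoc]
      _ = s * (v⁻¹ * z) * (v'⁻¹ * z') := by
          rw [← z_v'.inv_right.eq]; simp only [mul_assoc]
      _ = v⁻¹ * (s * (v'⁻¹ * z')) := by rw [← hz]; simp only [mul_assoc]
      _ = (v' * v)⁻¹ * s := by rw [← hz']; simp only [mul_inv_rev, mul_assoc]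
  rw [z_mul_z']
  exact (f_s.mul_right f_v.inv_right).inv_right.mul_right (f_v.inv_right.mul_right f_s)

theorem leg23_comm_braidingUnitary {H L K : Hilb.{u}} [Nontrivial H] {V : H ⊗ L ⟶ H ⊗ L}
    {F : L ⊗ L ⟶ L ⊗ L} {S : K ⊗ H ⟶ K ⊗ H} {Z : K ⊗ L ⟶ K ⊗ L} (hV : IsUnitary V)
    (hF : IsUnitary F) (hS : IsUnitary S) (hZ : IsBraidingUnitary V S Z)
    (F_V : leg13 L V ∘ₒ leg12 L V ∘ₒ leg23 H F = leg23 H F ∘ₒ leg13 L V ∘ₒ leg12 L V) :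
    leg23 K F ∘ₒ leg12 L Z ∘ₒ leg13 L Z = leg12 L Z ∘ₒ leg13 L Z ∘ₒ leg23 K F := by
  have hZ_eq := (isBraidingUnitary_iff hV hS hZ.unitary).1 hZ
  obtain ⟨hZ, -⟩ := hZ
  lift V to unitary (End (H ⊗ L)) using hV
  lift F to unitary (End (L ⊗ L)) using hF
  lift S to unitary (End (K ⊗ H)) using hS
  lift Z to unitary (End (K ⊗ L)) using hZ
  have e₁ : uleg23 K V⁻¹ * uleg12 L S = uleg12 L S * (uleg23 K V⁻¹ * uleg13 H Z) :=
    Subtype.ext hZ_eq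
  have e₂ : uleg13 L V * (uleg12 L V * uleg23 H F) = uleg23 H F * (uleg13 L V * uleg12 L V) :=
    Subtype.ext F_V
  have e₃ := congrArg (uleg12 L) e₁
  have e₄ := congrArg (uleg13 L) e₁
  replace e₂ := congrArg (uleg234 K) e₂
  simp only [map_mul, map_inv, uleg13_uleg12, uleg234_uleg12, uleg234_uleg13, uleg234_uleg23]
    at e₂ e₃ e₄
  suffices Commute (uleg23 K F) (uleg12 L Z * uleg13 L Z) from
    (congrArg Subtype.val this.eq).trans (Category.assoc _ _ _).symm
  refine uleg134_injective (B := H) ?_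
  simp only [map_mul, uleg134_uleg12, uleg134_uleg13, uleg134_uleg23]
  exact commute_mul_of_commute_mul e₃ e₄ (commute_uleg13_uleg24 Z V)
    (e₂.symm.trans (mul_assoc _ _ _).symm) (commute_uleg12_uleg34 S F).symm

section TensorT

theorem pentagon_conj {G : Type*} [Group G] {f x x' c : G} (hx : f * x = x * x' * f)
    (f_c : Commute f c) : f * (c * x * c⁻¹) = c * x * c⁻¹ * (c * x' * c⁻¹) * f :=
  calc f * (c * x * c⁻¹) = c * (f * x) * c⁻¹ := by
        rw [← mul_assoc, ← mul_assoc, f_c.eq, mul_assoc c]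
    _ = c * x * x' * (c⁻¹ * f) := by rw [hx, ← f_c.inv_right.eq]; simp only [mul_assoc]
    _ = c * x * c⁻¹ * (c * x' * c⁻¹) * f := by simp only [mul_assoc, inv_mul_cancel_left]

theorem pentagon_mul {G : Type*} [Group G] {f x x' y y' : G} (hx : f * x = x * x' * f)
    (hy : f * y = y * y' * f) (y_x' : Commute y x') :
    f * (x * y) = x * y * (x' * y') * f :=
  calc f * (x * y) = x * x' * (f * y) := by rw [← mul_assoc, hx, mul_assoc]
    _ = x * (x' * y) * (y' * f) := by rw [hy]; simp only [mul_assoc]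
    _ = x * y * (x' * y') * f := by rw [← y_x'.eq]; simp only [mul_assoc]

theorem pentagon_braided_mul {G : Type*} [Group G] {f b x x' y y' z z' t t' : G}
    (hx : f * x = x * (b * (x' * (b⁻¹ * f)))) (hy : f * y = y * (b * (y' * (b⁻¹ * f))))
    (f_z : f * (z * z') = z * (z' * f)) (yang_baxter : z * (z' * b) = b * (z' * z))
    (y_z' : y * (b * z') = b * (z' * y)) (x_z' : Commute x z') (x'_z : Commute x' z)
    (x'_y : Commute x' y) (ht : t = z * (x * (z⁻¹ * y))) (ht' : t' = z' * (x' * (z'⁻¹ * y'))) :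
    f * t = t * (b * (t' * (b⁻¹ * f))) := by
  simp only [← mul_assoc] at hx hy f_z yang_baxter y_z' ht ht'
  have f_zz' : Commute f (z * z') := (mul_assoc f z z').symm.trans f_z
  have y_bz' : Commute y (b * z') := (mul_assoc y b z').symm.trans y_z'
  have hx' : f * x = x * (b * x' * b⁻¹) * f := by rw [hx]; group
  have hy' : f * y = y * (b * y' * b⁻¹) * f := by rw [hy]; group
  have conj_x : z * z' * x * (z * z')⁻¹ = z * x * z⁻¹ := by
    rw [mul_assoc z, ← x_z'.eq]
    group
  have conj_x' : z * z' * (b * x' * b⁻¹) * (z * z')⁻¹ = b * z' * x' * (b * z')⁻¹ :=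
    calc z * z' * (b * x' * b⁻¹) * (z * z')⁻¹ = z * z' * b * x' * (z * z' * b)⁻¹ := by group
      _ = b * z' * (z * x') * z⁻¹ * (b * z')⁻¹ := by rw [yang_baxter]; group
      _ = b * z' * x' * (b * z')⁻¹ := by rw [← x'_z.eq]; group
  have hx_conj := pentagon_conj hx' f_zz'
  rw [conj_x, conj_x'] at hx_conj
  rw [ht, ht', pentagon_mul hx_conj hy' ((y_bz'.mul_right x'_y.symm).mul_right y_bz'.inv_right)]
  group

variable {H L K K₁ K₂ : Hilb.{u}}

theorem leg23_braid_conj (V : H ⊗ L ⟶ H ⊗ L) (S : K ⊗ H ⟶ K ⊗ H) (T : K₁ ⊗ L ⟶ K₁ ⊗ L) :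
    leg23 K₁ (braid V S) ∘ₒ leg12 K T ∘ₒ leg23 K₁ (dualBraid V S) =
      leg23 K₁ (braidZ V S) ∘ₒ leg13 K T ∘ₒ leg23 K₁ (dag (braidZ V S)) := by
  simp only [dualBraid, braid, Hilb.dag_comp, dag_braiding, ← leg23_comp, leg13, Category.assoc]

theorem tensorT_eq (V : H ⊗ L ⟶ H ⊗ L) (T₁ : K₁ ⊗ L ⟶ K₁ ⊗ L) (S₂ : K₂ ⊗ H ⟶ K₂ ⊗ H)
    (T₂ : K₂ ⊗ L ⟶ K₂ ⊗ L) :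
    tensorT V T₁ S₂ T₂ = leg23 K₁ (braidZ V S₂) ∘ₒ leg13 K₂ T₁ ∘ₒ
      leg23 K₁ (dag (braidZ V S₂)) ∘ₒ leg23 K₁ T₂ := by
  simpa only [tensorT, Category.assoc] using
    congrArg (leg23 K₁ T₂ ≫ ·) (leg23_braid_conj V S₂ T₁)

theorem uleg_pentagon_tensor {F b : unitary (End (L ⊗ L))} {T₁ : unitary (End (K₁ ⊗ L))}
    {T₂ Z : unitary (End (K₂ ⊗ L))} {T : unitary (End ((K₁ ⊗ K₂) ⊗ L))}
    (h₁ : uleg23 K₁ F * uleg12 L T₁ =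
      uleg12 L T₁ * (uleg23 K₁ b * (uleg13 L T₁ * (uleg23 K₁ b⁻¹ * uleg23 K₁ F))))
    (h₂ : uleg23 K₂ F * uleg12 L T₂ =
      uleg12 L T₂ * (uleg23 K₂ b * (uleg13 L T₂ * (uleg23 K₂ b⁻¹ * uleg23 K₂ F))))
    (F_Z : uleg23 K₂ F * (uleg12 L Z * uleg13 L Z) = uleg12 L Z * (uleg13 L Z * uleg23 K₂ F))
    (yang_baxter : uleg12 L Z * (uleg13 L Z * uleg23 K₂ b) =
      uleg23 K₂ b * (uleg13 L Z * uleg12 L Z))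
    (T_Z : uleg12 L T₂ * (uleg23 K₂ b * uleg13 L Z) = uleg23 K₂ b * (uleg13 L Z * uleg12 L T₂))
    (hT : T = uleg23 K₁ Z * (uleg13 K₂ T₁ * (uleg23 K₁ Z⁻¹ * uleg23 K₁ T₂))) :
    uleg23 (K₁ ⊗ K₂) F * uleg12 L T = uleg12 L T * (uleg23 (K₁ ⊗ K₂) b *
      (uleg13 L T * (uleg23 (K₁ ⊗ K₂) b⁻¹ * uleg23 (K₁ ⊗ K₂) F))) := by
  replace h₁ := congrArg (uleg134 K₂) h₁
  replace h₂ := congrArg (uleg234 K₁) h₂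
  replace F_Z := congrArg (uleg234 K₁) F_Z
  replace yang_baxter := congrArg (uleg234 K₁) yang_baxter
  replace T_Z := congrArg (uleg234 K₁) T_Z
  simp only [map_mul, map_inv, uleg134_uleg12, uleg134_uleg13, uleg134_uleg23, uleg234_uleg12,
    uleg234_uleg13, uleg234_uleg23] at h₁ h₂ F_Z yang_baxter T_Z ⊢
  refine pentagon_braided_mul h₁ h₂ F_Z yang_baxter T_Z (commute_uleg13_uleg24 T₁ Z)
    (commute_uleg14_uleg23 T₁ Z) (commute_uleg14_uleg23 T₁ T₂) ?_ ?_
  all_goals simp only [hT, map_mul, map_inv]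

theorem braided_rep_tensor {F b : L ⊗ L ⟶ L ⊗ L} {T₁ : K₁ ⊗ L ⟶ K₁ ⊗ L}
    {T₂ Z : K₂ ⊗ L ⟶ K₂ ⊗ L} {T : (K₁ ⊗ K₂) ⊗ L ⟶ (K₁ ⊗ K₂) ⊗ L} (hF : IsUnitary F)
    (hb : IsUnitary b) (hT₁ : IsUnitary T₁) (hT₂ : IsUnitary T₂) (hZ : IsUnitary Z)
    (hT : IsUnitary T)
    (h₁ : leg23 K₁ F ∘ₒ leg12 L T₁ =
      leg12 L T₁ ∘ₒ leg23 K₁ b ∘ₒ leg13 L T₁ ∘ₒ leg23 K₁ (dag b) ∘ₒ leg23 K₁ F)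
    (h₂ : leg23 K₂ F ∘ₒ leg12 L T₂ =
      leg12 L T₂ ∘ₒ leg23 K₂ b ∘ₒ leg13 L T₂ ∘ₒ leg23 K₂ (dag b) ∘ₒ leg23 K₂ F)
    (F_Z : leg23 K₂ F ∘ₒ leg12 L Z ∘ₒ leg13 L Z = leg12 L Z ∘ₒ leg13 L Z ∘ₒ leg23 K₂ F)
    (yang_baxter : leg12 L Z ∘ₒ leg13 L Z ∘ₒ leg23 K₂ b = leg23 K₂ b ∘ₒ leg13 L Z ∘ₒ leg12 L Z)
    (T_Z : leg12 L T₂ ∘ₒ leg23 K₂ b ∘ₒ leg13 L Z = leg23 K₂ b ∘ₒ leg13 L Z ∘ₒ leg12 L T₂)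
    (T_eq : T = leg23 K₁ Z ∘ₒ leg13 K₂ T₁ ∘ₒ leg23 K₁ (dag Z) ∘ₒ leg23 K₁ T₂) :
    leg23 (K₁ ⊗ K₂) F ∘ₒ leg12 L T = leg12 L T ∘ₒ leg23 (K₁ ⊗ K₂) b ∘ₒ leg13 L T ∘ₒ
      leg23 (K₁ ⊗ K₂) (dag b) ∘ₒ leg23 (K₁ ⊗ K₂) F := by
  lift F to unitary (End (L ⊗ L)) using hF
  lift b to unitary (End (L ⊗ L)) using hb
  lift T₁ to unitary (End (K₁ ⊗ L)) using hT₁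
  lift T₂ to unitary (End (K₂ ⊗ L)) using hT₂
  lift Z to unitary (End (K₂ ⊗ L)) using hZ
  lift T to unitary (End ((K₁ ⊗ K₂) ⊗ L)) using hT
  exact congrArg Subtype.val (uleg_pentagon_tensor (Subtype.ext h₁) (Subtype.ext h₂)
    (Subtype.ext F_Z) (Subtype.ext yang_baxter) (Subtype.ext T_Z) (Subtype.ext T_eq))

end TensorT

end Hilb

namespace BraidedMultUnitary

variable {H L K : Hilb.{u}} {B : BraidedMultUnitary H L}

section Braiding

variable {S : K ⊗ H ⟶ K ⊗ H} {T : K ⊗ L ⟶ K ⊗ L}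

theorem IsRep.intertwines_T (h : B.IsRep S T) : Intertwines T (tensorS S B.U) (tensorS S B.U) :=
  h.T_equivariant.symm.trans (Category.assoc _ _ _)

variable [Nontrivial H]

theorem intertwines_braid (hS : IsRightRep B.W S) (hZ : HasBraiding B.V S) :
    Intertwines (braid B.V S) (tensorS B.U S) (tensorS S B.U) :=
  ((Intertwines.braiding_leg23 S).comp (Intertwines.braiding_leg13 B.U)).trans
    (intertwines_braidingUnitary B.W_mult.unitary B.U_rep.unitary B.V_rep.unitary hS B.drinfeld
      (braidZ_spec hZ))

theorem intertwines_dualBraid (hS : IsRightRep B.W S) (hZ : HasBraiding B.V S) :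
    Intertwines (dualBraid B.V S) (tensorS S B.U) (tensorS B.U S) :=
  (intertwines_braid hS hZ).adjoint (B.U_rep.unitary.tensorS hS.unitary)
    (hS.unitary.tensorS B.U_rep.unitary)

theorem yang_baxter (hS : IsRightRep B.W S) (hZ : HasBraiding B.V S) :
    leg12 L (braidZ B.V S) ∘ₒ leg13 L (braidZ B.V S) ∘ₒ leg23 K (braidZ B.V B.U) =
      leg23 K (braidZ B.V B.U) ∘ₒ leg13 L (braidZ B.V S) ∘ₒ leg12 L (braidZ B.V S) := by
  have hV := B.V_rep.unitary
  have hU := B.U_rep.unitary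
  have h := (intertwines_braid hS hZ).braiding (hU.tensorS hS.unitary) (hS.unitary.tensorS hU)
    (.tensorS hV hU hS.unitary (braidZ_spec B.U_braid) (braidZ_spec hZ))
    (.tensorS hV hS.unitary hU (braidZ_spec hZ) (braidZ_spec B.U_braid))
  have flip := (Intertwines.braiding_leg13 (B := K) (braidZ B.V B.U)).comp
    (Intertwines.braiding_leg23 (B := L) (braidZ B.V S))
  rw [Intertwines, braid, comp_whiskerRight, ← Category.assoc, flip] at h
  simpa only [Category.assoc, leg12, cancel_epi] using h

theorem IsRep.commute_braiding (h : B.IsRep S T) :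
    leg12 L T ∘ₒ leg23 K (braidZ B.V B.U) ∘ₒ leg13 L (braidZ B.V S) =
      leg23 K (braidZ B.V B.U) ∘ₒ leg13 L (braidZ B.V S) ∘ₒ leg12 L T := by
  have hS := h.S_rep.unitary
  have hb := IsBraidingUnitary.tensorS B.V_rep.unitary hS B.U_rep.unitary
    (braidZ_spec h.S_braid) (braidZ_spec B.U_braid)
  have hSU := hS.tensorS B.U_rep.unitary
  have key : Intertwines T _ _ := h.intertwines_T.braiding hSU hSU hb hb
  rw [Intertwines, ← Category.assoc] at key
  exact key

end Braiding

section TensorRep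

variable {H L K K₁ K₂ : Hilb.{u}} {B : BraidedMultUnitary H L} {S₁ : K₁ ⊗ H ⟶ K₁ ⊗ H}
  {T₁ : K₁ ⊗ L ⟶ K₁ ⊗ L} {S₂ : K₂ ⊗ H ⟶ K₂ ⊗ H} {T₂ : K₂ ⊗ L ⟶ K₂ ⊗ L}

theorem T_rep_iff (T : K ⊗ L ⟶ K ⊗ L) :
    (leg23 K B.F ∘ₒ leg12 L T = leg12 L T ∘ₒ leg23 K (braid B.V B.U) ∘ₒ leg12 L T ∘ₒ
      leg23 K (dualBraid B.V B.U) ∘ₒ leg23 K B.F) ↔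
    leg23 K B.F ∘ₒ leg12 L T = leg12 L T ∘ₒ leg23 K (braidZ B.V B.U) ∘ₒ leg13 L T ∘ₒ
      leg23 K (dag (braidZ B.V B.U)) ∘ₒ leg23 K B.F := by
  have conj := congrArg (fun X => leg23 K B.F ≫ X ≫ leg12 L T) (leg23_braid_conj B.V B.U T)
  simp only [Category.assoc] at conj ⊢
  rw [conj]

theorem isUnitary_tensorT (hT₁ : IsUnitary T₁) (hT₂ : IsUnitary T₂) (hZ : HasBraiding B.V S₂) :
    IsUnitary (tensorT B.V T₁ S₂ T₂) :=
  ((hT₂.leg23.comp (isUnitary_braid hZ).dag.leg23).comp hT₁.leg12).comp (isUnitary_braid hZ).leg23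

variable [Nontrivial H]

theorem IsRep.intertwines_tensorT (h₁ : B.IsRep S₁ T₁) (h₂ : B.IsRep S₂ T₂) :
    Intertwines (tensorT B.V T₁ S₂ T₂) (tensorS (tensorS S₁ S₂) B.U)
      (tensorS (tensorS S₁ S₂) B.U) :=
  (((h₂.intertwines_T.leg23_tensorS S₁).trans
    ((intertwines_dualBraid h₂.S_rep h₂.S_braid).leg23_tensorS S₁)).trans
      (h₁.intertwines_T.tensorS_whiskerRight S₂)).trans
        ((intertwines_braid h₂.S_rep h₂.S_braid).leg23_tensorS S₁)

theorem IsRep.tensor (h₁ : B.IsRep S₁ T₁) (h₂ : B.IsRep S₂ T₂) :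
    B.IsRep (tensorS S₁ S₂) (tensorT B.V T₁ S₂ T₂) where
  S_rep := h₁.S_rep.tensorS h₂.S_rep
  S_braid := ⟨_, .tensorS B.V_rep.unitary h₁.S_rep.unitary h₂.S_rep.unitary
    (braidZ_spec h₁.S_braid) (braidZ_spec h₂.S_braid)⟩
  T_unitary := isUnitary_tensorT h₁.T_unitary h₂.T_unitary h₂.S_braid
  T_equivariant := (Category.assoc _ _ _).trans (h₁.intertwines_tensorT h₂).symm
  T_rep := (T_rep_iff _).2 <| braided_rep_tensor B.F_unitary (braidZ_spec B.U_braid).unitary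
    h₁.T_unitary h₂.T_unitary (braidZ_spec h₂.S_braid).unitary
    (isUnitary_tensorT h₁.T_unitary h₂.T_unitary h₂.S_braid)
    ((T_rep_iff T₁).1 h₁.T_rep) ((T_rep_iff T₂).1 h₂.T_rep)
    (leg23_comm_braidingUnitary B.V_rep.unitary B.F_unitary h₂.S_rep.unitary
      (braidZ_spec h₂.S_braid) B.F_V)
    (yang_baxter h₂.S_rep h₂.S_braid) h₂.commute_braiding (tensorT_eq _ _ _ _)

end TensorRep

end BraidedMultUnitary

namespace Hilb

section TensorT

variable {H L K K₁ K₁' K₂ K₂' K₃ : Hilb.{u}} {V : H ⊗ L ⟶ H ⊗ L} {T₁ : K₁ ⊗ L ⟶ K₁ ⊗ L}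
  {T₁' : K₁' ⊗ L ⟶ K₁' ⊗ L} {S₂ : K₂ ⊗ H ⟶ K₂ ⊗ H} {S₂' : K₂' ⊗ H ⟶ K₂' ⊗ H}
  {T₂ : K₂ ⊗ L ⟶ K₂ ⊗ L} {T₂' : K₂' ⊗ L ⟶ K₂' ⊗ L}

theorem tensorT_id_left (hZ : HasBraiding V S₂) (T₂ : K₂ ⊗ L ⟶ K₂ ⊗ L) :
    tensorT V (𝟙 (K ⊗ L)) S₂ T₂ = leg23 K T₂ := by
  rw [tensorT_eq, leg13_id, Category.comp_id, Category.assoc, leg23_comp,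
    (braidZ_spec hZ).unitary.dag_comp, leg23_id, Category.comp_id]

theorem tensorT_id_right [Nontrivial H] (hV : IsUnitary V) (T₁ : K₁ ⊗ L ⟶ K₁ ⊗ L) :
    tensorT V T₁ (𝟙 (K ⊗ H)) (𝟙 (K ⊗ L)) = leg13 K T₁ := by
  rw [tensorT_eq, (isBraidingUnitary_id hV K).braidZ_eq, dag_id, leg23_id, Category.id_comp,
    Category.comp_id, Category.id_comp]

namespace Intertwines

variable {a : K₁ ⟶ K₁'} {b : K₂ ⟶ K₂'}

theorem tensorT_whiskerRight (h : Intertwines a T₁ T₁') (V : H ⊗ L ⟶ H ⊗ L)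
    (S₂ : K₂ ⊗ H ⟶ K₂ ⊗ H) (T₂ : K₂ ⊗ L ⟶ K₂ ⊗ L) :
    Intertwines (a ▷ K₂) (tensorT V T₁ S₂ T₂) (tensorT V T₁' S₂ T₂) := by
  simp only [tensorT_eq]
  exact (((leg23_whiskerRight a T₂).comp (leg23_whiskerRight a _)).comp (h.leg13 K₂)).comp
    (leg23_whiskerRight a _)

theorem tensorT_whiskerRight_iff [Nontrivial K₂] (hZ : HasBraiding V S₂) (hT₂ : IsUnitary T₂) :
    Intertwines (a ▷ K₂) (tensorT V T₁ S₂ T₂) (tensorT V T₁' S₂ T₂) ↔ Intertwines a T₁ T₁' := by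
  have hZ := (braidZ_spec hZ).unitary
  simp only [tensorT_eq]
  rw [comp_iff_left hZ.leg23 (leg23_whiskerRight a _), comp_iff_right (hT₂.leg23.comp hZ.dag.leg23)
    ((leg23_whiskerRight a T₂).comp (leg23_whiskerRight a _)), leg13_iff]

theorem tensorT_whiskerLeft (hZ : HasBraiding V S₂) (hZ' : HasBraiding V S₂')
    (h : Intertwines b T₂ T₂') (h_braid : Intertwines b (braidZ V S₂) (braidZ V S₂'))
    (T₁ : K₁ ⊗ L ⟶ K₁ ⊗ L) :
    Intertwines (K₁ ◁ b) (tensorT V T₁ S₂ T₂) (tensorT V T₁ S₂' T₂') := by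
  have h_dag := h_braid.dag_operators (braidZ_spec hZ).unitary (braidZ_spec hZ').unitary
  simp only [tensorT_eq]
  exact (((h.leg23 K₁).comp (h_dag.leg23 K₁)).comp (leg13_whiskerLeft b T₁)).comp
    (h_braid.leg23 K₁)

theorem tensorT_whiskerLeft_iff [Nontrivial K₁] (hZ : HasBraiding V S₂) (hZ' : HasBraiding V S₂')
    (h_braid : Intertwines b (braidZ V S₂) (braidZ V S₂')) (hT₁ : IsUnitary T₁) :
    Intertwines (K₁ ◁ b) (tensorT V T₁ S₂ T₂) (tensorT V T₁ S₂' T₂') ↔ Intertwines b T₂ T₂' := by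
  have hZ := (braidZ_spec hZ).unitary
  have hZ' := (braidZ_spec hZ').unitary
  simp only [tensorT_eq]
  rw [comp_iff_left hZ'.leg23 (h_braid.leg23 K₁),
    comp_iff_left hT₁.leg13 (leg13_whiskerLeft b T₁),
    comp_iff_left hZ'.dag.leg23 ((h_braid.dag_operators hZ hZ').leg23 K₁), leg23_iff]

theorem tensorT_associator [Nontrivial H] {S₃ : K₃ ⊗ H ⟶ K₃ ⊗ H} (hV : IsUnitary V)
    (hS₂ : IsUnitary S₂) (hS₃ : IsUnitary S₃) (hZ₂ : HasBraiding V S₂) (hZ₃ : HasBraiding V S₃)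
    (T₁ : K₁ ⊗ L ⟶ K₁ ⊗ L) (T₂ : K₂ ⊗ L ⟶ K₂ ⊗ L) (T₃ : K₃ ⊗ L ⟶ K₃ ⊗ L) :
    Intertwines (α_ K₁ K₂ K₃).hom (tensorT V (tensorT V T₁ S₂ T₂) S₃ T₃)
      (tensorT V T₁ (tensorS S₂ S₃) (tensorT V T₂ S₃ T₃)) := by
  have hZ₂ := braidZ_spec hZ₂
  have hZ₃ := braidZ_spec hZ₃
  have cancel : Hilb.leg23 K₁ (Hilb.leg23 K₂ (braidZ V S₃)) ≫
      Hilb.leg23 K₁ (Hilb.leg23 K₂ (dag (braidZ V S₃))) = 𝟙 _ := by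
    rw [leg23_comp, leg23_comp, hZ₃.unitary.comp_dag, leg23_id, leg23_id]
  have lift₁ (X : K₁ ⊗ L ⟶ K₁ ⊗ L) := associator_leg14 (B := K₂) (D := K₃) X
  have lift₂ (X : K₂ ⊗ L ⟶ K₂ ⊗ L) := associator_leg24 (D := K₃) K₁ X
  have lift₃ (X : K₃ ⊗ L ⟶ K₃ ⊗ L) := associator_leg34 K₁ K₂ X
  simp only [tensorT_eq, (IsBraidingUnitary.tensorS hV hS₂ hS₃ hZ₂ hZ₃).braidZ_eq, Hilb.dag_comp,
    dag_leg13, dag_leg23, ← leg13_comp, ← leg23_comp, Category.assoc, reassoc_of% cancel]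
  exact (lift₃ T₃).comp <| (lift₃ _).comp <| (lift₂ T₂).comp <| (lift₂ _).comp <|
    (lift₁ T₁).comp <| (lift₂ _).comp (lift₃ _)

theorem tensorT_leftUnitor (hZ : HasBraiding V S₂) (T₂ : K₂ ⊗ L ⟶ K₂ ⊗ L) :
    Intertwines (λ_ K₂).hom (tensorT V (𝟙 (𝟙_ Hilb.{u} ⊗ L : Hilb.{u})) S₂ T₂) T₂ := by
  rw [tensorT_id_left hZ]
  exact .leftUnitor T₂

theorem tensorT_rightUnitor [Nontrivial H] (hV : IsUnitary V) (T₁ : K₁ ⊗ L ⟶ K₁ ⊗ L) :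
    Intertwines (ρ_ K₁).hom (tensorT V T₁ (𝟙 (𝟙_ Hilb.{u} ⊗ H : Hilb.{u}))
      (𝟙 (𝟙_ Hilb.{u} ⊗ L : Hilb.{u}))) T₁ := by
  rw [tensorT_id_right hV]
  exact .rightUnitor T₁

end Intertwines

end TensorT

end Hilb

namespace BraidedMultUnitary

variable {H L : Hilb.{u}} {B : BraidedMultUnitary H L}

namespace Rep

/-- The isomorphism of representations given by an isomorphism of Hilbert spaces that intertwines
them. -/
def isoMk {x y : B.Rep} (e : x.K ≅ y.K) (hS : Intertwines e.hom x.S y.S)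
    (hT : Intertwines e.hom x.T y.T) : x ≅ y where
  hom := ⟨e.hom, hS, hT⟩
  inv := ⟨e.inv, hS.inv, hT.inv⟩
  hom_inv_id := Rep.Hom.ext e.hom_inv_id
  inv_hom_id := Rep.Hom.ext e.inv_hom_id

variable [Nontrivial H]

theorem intertwines_braidZ {x y : B.Rep} {a : x.K ⟶ y.K} (h : Intertwines a x.S y.S) :
    Intertwines a (braidZ B.V x.S) (braidZ B.V y.S) :=
  h.braiding x.isRep.S_rep.unitary y.isRep.S_rep.unitary (braidZ_spec x.isRep.S_braid)
    (braidZ_spec y.isRep.S_braid)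

/-- The tensor product of representations. -/
noncomputable def tensor (x y : B.Rep) : B.Rep :=
  ⟨x.K ⊗ y.K, tensorS x.S y.S, tensorT B.V x.T y.S y.T, x.isRep.tensor y.isRep⟩

/-- The whiskering `id ⊗ f` of an arrow of representations. -/
noncomputable def tensorWhiskerLeft (x : B.Rep) {y y' : B.Rep} (f : y ⟶ y') :
    tensor x y ⟶ tensor x y' :=
  ⟨x.K ◁ f.map, Intertwines.tensorS_whiskerLeft f.S_comm x.S,
    Intertwines.tensorT_whiskerLeft y.isRep.S_braid y'.isRep.S_braid f.T_comm
      (intertwines_braidZ f.S_comm) x.T⟩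

/-- The whiskering `f ⊗ id` of an arrow of representations. -/
noncomputable def tensorWhiskerRight {x x' : B.Rep} (f : x ⟶ x') (y : B.Rep) :
    tensor x y ⟶ tensor x' y :=
  ⟨f.map ▷ y.K, Intertwines.tensorS_whiskerRight f.S_comm y.S,
    Intertwines.tensorT_whiskerRight f.T_comm B.V y.S y.T⟩

/-- The tensor product of representations, with the structure of the category of Hilbert spaces. -/
@[reducible]
noncomputable def monoidalCategoryStruct : MonoidalCategoryStruct B.Rep where
  tensorObj := tensor
  whiskerLeft x _ _ f := tensorWhiskerLeft x f
  whiskerRight f y := tensorWhiskerRight f y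
  tensorHom {_ x' y _} f g :=
    ⟨f.map ⊗ₘ g.map,
      by
        rw [MonoidalCategory.tensorHom_def]
        exact (tensorWhiskerRight f y ≫ tensorWhiskerLeft x' g).S_comm,
      by
        rw [MonoidalCategory.tensorHom_def]
        exact (tensorWhiskerRight f y ≫ tensorWhiskerLeft x' g).T_comm⟩
  tensorUnit := B.trivial.obj (𝟙_ Hilb.{u})
  associator x y z := isoMk (α_ x.K y.K z.K) (.tensorS_associator x.S y.S z.S)
    (.tensorT_associator B.V_rep.unitary y.isRep.S_rep.unitary z.isRep.S_rep.unitary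
      y.isRep.S_braid z.isRep.S_braid x.T y.T z.T)
  leftUnitor x := isoMk (λ_ x.K) (.tensorS_leftUnitor x.S)
    (.tensorT_leftUnitor x.isRep.S_braid x.T)
  rightUnitor x := isoMk (ρ_ x.K) (.tensorS_rightUnitor x.S)
    (.tensorT_rightUnitor B.V_rep.unitary x.T)

attribute [local instance] monoidalCategoryStruct

/-- The monoidal category of representations. -/
@[reducible]
noncomputable def monoidalCategory : MonoidalCategory B.Rep where
  tensorHom_def f g := Rep.Hom.ext (MonoidalCategory.tensorHom_def f.map g.map)
  id_tensorHom_id x y := Rep.Hom.ext (MonoidalCategory.id_tensorHom_id x.K y.K)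
  tensorHom_comp_tensorHom f₁ f₂ g₁ g₂ := Rep.Hom.ext
    (MonoidalCategory.tensorHom_comp_tensorHom f₁.map f₂.map g₁.map g₂.map)
  whiskerLeft_id x y := Rep.Hom.ext (MonoidalCategory.whiskerLeft_id x.K y.K)
  id_whiskerRight x y := Rep.Hom.ext (MonoidalCategory.id_whiskerRight x.K y.K)
  associator_naturality f₁ f₂ f₃ := Rep.Hom.ext
    (MonoidalCategory.associator_naturality f₁.map f₂.map f₃.map)
  leftUnitor_naturality f := Rep.Hom.ext (MonoidalCategory.leftUnitor_naturality f.map)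
  rightUnitor_naturality f := Rep.Hom.ext (MonoidalCategory.rightUnitor_naturality f.map)
  pentagon w x y z := Rep.Hom.ext (MonoidalCategory.pentagon w.K x.K y.K z.K)
  triangle x y := Rep.Hom.ext (MonoidalCategory.triangle x.K y.K)

end Rep

end BraidedMultUnitary

namespace Hilb

variable {A B C : Hilb.{u}}

/-- The slice `(id ⊗ ω)(X)` of an operator `X` by the vector functional `ω = ⟨c', · c⟩`. -/
noncomputable def slice (X : A ⊗ C ⟶ A ⊗ C) (c c' : C) : A ⟶ A :=
  insr A c ≫ X ≫ dag (insr A c')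

theorem intertwines_iff_slice {X : A ⊗ C ⟶ A ⊗ C} {X' : B ⊗ C ⟶ B ⊗ C} {a : A ⟶ B} :
    Intertwines a X X' ↔ ∀ c c', slice X c c' ≫ a = a ≫ slice X' c c' := by
  have slice_left (c c' : C) :
      slice X c c' ≫ a = insr A c ≫ (X ≫ a ▷ C) ≫ dag (insr B c') := by
    simp only [slice, Category.assoc, whiskerRight_dag_insr]
  have slice_right (c c' : C) :
      a ≫ slice X' c c' = insr A c ≫ (a ▷ C ≫ X') ≫ dag (insr B c') := by
    simp only [slice, Category.assoc, reassoc_of% insr_whiskerRight a c]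
  simp only [slice_left, slice_right]
  exact ⟨fun h c c' => by rw [h], fun h => ext_dag_insr fun c' => ext_insr fun c => h c c'⟩

/-- The space of operators that intertwine two given operators, see `mem_intertwiners`. It is
defined through slices, in terms of which intertwining is visibly linear and weakly closed. -/
noncomputable def intertwiners (X : A ⊗ C ⟶ A ⊗ C) (X' : B ⊗ C ⟶ B ⊗ C) :
    Submodule ℂ (A →L[ℂ] B) where
  carrier := {a | ∀ c c', a.comp (slice X c c').clm = (slice X' c c').clm.comp a}
  zero_mem' c c' := by rw [ContinuousLinearMap.zero_comp, ContinuousLinearMap.comp_zero]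
  add_mem' ha hb c c' := by
    rw [ContinuousLinearMap.add_comp, ContinuousLinearMap.comp_add, ha, hb]
  smul_mem' r a ha c c' := by
    rw [ContinuousLinearMap.smul_comp, ContinuousLinearMap.comp_smul, ha]

theorem mem_intertwiners {X : A ⊗ C ⟶ A ⊗ C} {X' : B ⊗ C ⟶ B ⊗ C} {a : A ⟶ B} :
    a.clm ∈ intertwiners X X' ↔ Intertwines a X X' :=
  ⟨fun h => intertwines_iff_slice.2 fun c c' => Hom.ext (h c c'),
    fun h c c' => congrArg Hom.clm (intertwines_iff_slice.1 h c c')⟩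

theorem isClosed_intertwiners (X : A ⊗ C ⟶ A ⊗ C) (X' : B ⊗ C ⟶ B ⊗ C) :
    IsClosed {a : A →WOT[ℂ] B | a.toCLM ∈ intertwiners X X'} := by
  have matrix_coefficients : {a : A →WOT[ℂ] B | a.toCLM ∈ intertwiners X X'} =
      ⋂ (c : C) (c' : C) (v : A) (φ : StrongDual ℂ B),
        {a | φ (a ((slice X c c').clm v)) = (φ.comp (slice X' c c').clm) (a v)} := by
    ext a
    simp only [Set.mem_iInter, Set.mem_ofPred_eq]
    refine ⟨fun ha c c' v φ => congrArg φ (DFunLike.congr_fun (ha c c') v), fun ha c c' => ?_⟩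
    ext v
    exact (SeparatingDual.eq_iff_forall_dual_eq (R := ℂ)).2 (ha c c' v)
  rw [matrix_coefficients]
  exact isClosed_iInter fun c => isClosed_iInter fun c' => isClosed_iInter fun v =>
    isClosed_iInter fun φ => isClosed_eq (ContinuousLinearMapWOT.continuous_dual_apply _ _)
      (ContinuousLinearMapWOT.continuous_dual_apply _ _)

end Hilb

namespace BraidedMultUnitary

variable {H L : Hilb.{u}} (B : BraidedMultUnitary H L)

theorem exists_hom_iff {x y : B.Rep} (a : x.K →L[ℂ] y.K) :
    (∃ f : x ⟶ y, (B.forget.map f).clm = a) ↔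
      a ∈ intertwiners x.S y.S ⊓ intertwiners x.T y.T := by
  constructor
  · rintro ⟨f, rfl⟩
    exact ⟨mem_intertwiners.2 f.S_comm, mem_intertwiners.2 f.T_comm⟩
  · rintro ⟨hS, hT⟩
    exact ⟨⟨⟨a⟩, (mem_intertwiners (a := ⟨a⟩)).1 hS, (mem_intertwiners (a := ⟨a⟩)).1 hT⟩, rfl⟩

theorem isConcreteWStar_forget : IsConcreteWStar B.forget where
  faithful := ⟨fun h => Rep.Hom.ext h⟩
  linear x y := ⟨intertwiners x.S y.S ⊓ intertwiners x.T y.T,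
    Set.ext fun a => (B.exists_hom_iff a).symm⟩
  adjoint {x y} f := ⟨⟨dag f.map,
    Intertwines.adjoint x.isRep.S_rep.unitary y.isRep.S_rep.unitary f.S_comm,
    Intertwines.adjoint x.isRep.T_unitary y.isRep.T_unitary f.T_comm⟩, rfl⟩
  weakly_closed x y := by
    have h : {a : B.forget.obj x →WOT[ℂ] B.forget.obj y |
          ∃ f : x ⟶ y, (B.forget.map f).clm = a.toCLM} =
        {a | a.toCLM ∈ intertwiners x.S y.S} ∩ {a | a.toCLM ∈ intertwiners x.T y.T} :=
      Set.ext fun a => B.exists_hom_iff a.toCLM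
    rw [h]
    exact (isClosed_intertwiners _ _).inter (isClosed_intertwiners _ _)

variable {B}

namespace Rep

theorem mk_congr {K : Hilb.{u}} {S S' : K ⊗ H ⟶ K ⊗ H} {T T' : K ⊗ L ⟶ K ⊗ L}
    {h : B.IsRep S T} {h' : B.IsRep S' T'} (hS : S = S') (hT : T = T') :
    (⟨K, S, T, h⟩ : B.Rep) = ⟨K, S', T', h'⟩ := by
  subst hS hT
  rfl

theorem Hom.heq {x x' y y' : B.Rep} (hx : x = x') (hy : y = y') {f : x ⟶ y} {g : x' ⟶ y'}
    (h : HEq f.map g.map) : HEq f g := by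
  subst hx hy
  exact heq_of_eq (Hom.ext (eq_of_heq h))

theorem eq_of_map_eq_eqToHom {x x' : B.Rep} (h : x.K = x'.K) (f : x ⟶ x')
    (hf : f.map = eqToHom h) : x = x' := by
  obtain ⟨K, S, T, hx⟩ := x
  obtain ⟨K', S', T', hx'⟩ := x'
  obtain rfl : K = K' := h
  have hS : Intertwines f.map S S' := f.S_comm
  have hT : Intertwines f.map T T' := f.T_comm
  rw [hf, eqToHom_refl] at hS hT
  exact mk_congr (intertwines_id_iff.1 hS) (intertwines_id_iff.1 hT)

variable [Nontrivial H]

attribute [local instance] monoidalCategory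

theorem trivial_tensor (K₁ K₂ : Hilb.{u}) :
    B.trivial.obj (K₁ ⊗ K₂) = B.trivial.obj K₁ ⊗ B.trivial.obj K₂ :=
  mk_congr ((tensorS_id_left _).trans leg23_id).symm
    ((tensorT_id_left (B.isRep_trivial K₂).S_braid _).trans leg23_id).symm

theorem exists_hom_of_whiskerRight {x₁ x₂ y : B.Rep} [Nontrivial y.K] {a : x₁.K ⟶ x₂.K}
    (f : x₁ ⊗ y ⟶ x₂ ⊗ y) (hf : f.map = a ▷ y.K) : ∃ g : x₁ ⟶ x₂, g.map = a := by
  have hS : Intertwines (a ▷ y.K) (tensorS x₁.S y.S) (tensorS x₂.S y.S) := hf ▸ f.S_comm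
  have hT : Intertwines (a ▷ y.K) (tensorT B.V x₁.T y.S y.T) (tensorT B.V x₂.T y.S y.T) :=
    hf ▸ f.T_comm
  exact ⟨⟨a, (Intertwines.tensorS_whiskerRight_iff y.isRep.S_rep.unitary).1 hS,
    (Intertwines.tensorT_whiskerRight_iff y.isRep.S_braid y.isRep.T_unitary).1 hT⟩, rfl⟩

theorem exists_hom_of_whiskerLeft {x₁ x₂ y : B.Rep} [Nontrivial y.K] {a : x₁.K ⟶ x₂.K}
    (f : y ⊗ x₁ ⟶ y ⊗ x₂) (hf : f.map = y.K ◁ a) : ∃ g : x₁ ⟶ x₂, g.map = a := by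
  have hS : Intertwines (y.K ◁ a) (tensorS y.S x₁.S) (tensorS y.S x₂.S) := hf ▸ f.S_comm
  have hT : Intertwines (y.K ◁ a) (tensorT B.V y.T x₁.S x₁.T) (tensorT B.V y.T x₂.S x₂.T) :=
    hf ▸ f.T_comm
  have ha : Intertwines a x₁.S x₂.S :=
    (Intertwines.tensorS_whiskerLeft_iff y.isRep.S_rep.unitary).1 hS
  exact ⟨⟨a, ha, (Intertwines.tensorT_whiskerLeft_iff x₁.isRep.S_braid x₂.isRep.S_braid
    (intertwines_braidZ ha) y.isRep.T_unitary).1 hT⟩, rfl⟩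

end Rep

variable [Nontrivial H]

attribute [local instance] Rep.monoidalCategory

theorem isStrictMonoidal_forget : IsStrictMonoidal B.forget where
  obj_tensor _ _ := rfl
  obj_unit := rfl
  map_tensor _ _ := HEq.rfl
  map_associator _ _ _ := HEq.rfl
  map_leftUnitor _ := HEq.rfl
  map_rightUnitor _ := HEq.rfl

theorem isStrictMonoidal_trivial : IsStrictMonoidal B.trivial where
  obj_tensor := Rep.trivial_tensor
  obj_unit := rfl
  map_tensor _ _ := Rep.Hom.heq (Rep.trivial_tensor _ _) (Rep.trivial_tensor _ _) HEq.rfl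
  map_associator _ _ _ := Rep.Hom.heq
    ((Rep.trivial_tensor _ _).trans (congrArg (· ⊗ _) (Rep.trivial_tensor _ _)))
    ((Rep.trivial_tensor _ _).trans (congrArg (_ ⊗ ·) (Rep.trivial_tensor _ _))) HEq.rfl
  map_leftUnitor _ := Rep.Hom.heq (Rep.trivial_tensor _ _) rfl HEq.rfl
  map_rightUnitor _ := Rep.Hom.heq (Rep.trivial_tensor _ _) rfl HEq.rfl

theorem isHilbertSpaceTensorCategory_rep : IsHilbertSpaceTensorCategory B.forget B.trivial where
  wstar := B.isConcreteWStar_forget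
  for_strict := isStrictMonoidal_forget
  tau_strict := isStrictMonoidal_trivial
  tau_for := rfl
  eq_of_id _ _ h f hf := Rep.eq_of_map_eq_eqToHom h f hf
  cancel_right _ _ y _ hy := fun ⟨f, hf⟩ =>
    haveI : Nontrivial y.K := hy
    Rep.exists_hom_of_whiskerRight f (eq_of_heq hf)
  cancel_left _ _ y _ hy := fun ⟨f, hf⟩ =>
    haveI : Nontrivial y.K := hy
    Rep.exists_hom_of_whiskerLeft f (eq_of_heq hf)

end BraidedMultUnitary

theorem mainTheorem9 {H L : Hilb.{u}} [Nontrivial H] (B : BraidedMultUnitary H L) :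
    ∃ _ : MonoidalCategory B.Rep,
      (∀ x y : B.Rep, ∃ h : B.IsRep (tensorS x.S y.S) (tensorT B.V x.T y.S y.T),
        x ⊗ y = ⟨x.K ⊗ y.K, tensorS x.S y.S, tensorT B.V x.T y.S y.T, h⟩) ∧
      IsHilbertSpaceTensorCategory B.forget B.trivial :=
  ⟨BraidedMultUnitary.Rep.monoidalCategory, fun x y => ⟨x.isRep.tensor y.isRep, rfl⟩,
    BraidedMultUnitary.isHilbertSpaceTensorCategory_rep⟩
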